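/- **Setting.** Let $n\in\{2,3\}$. A connected porous medium in $\mathbb R^n$ with flat fractures is decomposed into finitely many connected, pairwise disjoint, flat subdomains $\Omega^d_i$ of dimensions $0\le d\le n$ (rock, fractures, intersections of fractures, …). Each side of a lower-dimensional subdomain $\Omega_i^d$ that is adjacent to a subdomain of dimension $d+1$ is an interface $\Gamma^d_{ij}$, and any two subdomains are linked by a chain of interfaces. $\Omega$ and $\Gamma$ are the unions of the subdomains and of the interfaces. A part of positive measure of the outer boundary carries Dirichlet conditions; on the rest of the outer boundary and at immersed fracture tips there is no flow. Every subdomain carries a simplicial mesh, and every interface carries its own, independent simplicial mesh. Let $\boldsymbol V_h$ be the space of lowest-order Raviart–Thomas fields on the subdomain meshes (tangential to the subdomains, with normal components continuous inside each subdomain and zero on no-flow facets), $\boldsymbol V_{0h}\subset\boldsymbol V_h$ the subspace of fields with zero normal component on $\Gamma$, $\Lambda_h$ and $Q_h$ the piecewise constants on the interface meshes and on the subdomain meshes, and $\boldsymbol W_h=\boldsymbol V_{0h}\times\Lambda_h$. Let $\boldsymbol\nu$ be the outward unit normal. The extension $R_h:\Lambda_h\to\boldsymbol V_h$ is determined by $R_h\mu\cdot\boldsymbol\nu=\widehat\Pi_h\mu$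 on $\Gamma$ and $R_h\mu\cdot\boldsymbol\nu=0$ on all other facets, where $\widehat\Pi_h$ is the $L^2$-projection onto the normal components of $\boldsymbol V_h$ on $\Gamma$ (constants on each facet). Put $[\![\mu]\!]|_{\Omega_i^d}=-\sum_j\mu_{ij}$, the sum over all interfaces of $\Omega_i^d$. Let the permeability $K$ be a symmetric positive definite tensor, constant on each subdomain, $K_\nu$ a scalar normal permeability on the interfaces that is bounded above and below by positive constants, and $\gamma>0$ constant on each interface. For $\boldsymbol w=[\boldsymbol u_0,\lambda]$, $\boldsymbol r=[\boldsymbol v_0,\mu]$ in $\boldsymbol W_h$ and $p\in Q_h$ let $$a(\boldsymbol w,\boldsymbol r)=(K^{-1}(\boldsymbol u_0+R_h\lambda),\boldsymbol v_0+R_h\mu)_\Omega+(\gamma K_\nu^{-1}\lambda,\mu)_\Gamma,\qquad b(\boldsymbol r,p)=-(p,\nabla\cdot(\boldsymbol v_0+R_h\mu)+[\![\mu]\!])_\Omega,$$ $$a^D(\boldsymbol w,\boldsymbol r)=\sum_{T}\sum_{f\subset\partial T}\big((\boldsymbol u_0+R_h\lambda)\cdot\boldsymbol\nu_f\big)\big((\boldsymbol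 v_0+R_h\mu)\cdot\boldsymbol\nu_f\big)(K^{-1}\boldsymbol\phi_f,\boldsymbol\phi_f)_T+(\gamma K_\nu^{-1}\lambda,\mu)_\Gamma,$$ where $T$ runs over all cells of all subdomain meshes, $f$ over the facets of $T$, and $\boldsymbol\phi_f$ is the Raviart–Thomas basis function on $T$ with normal component $1$ on $f$ and $0$ on the other facets. Let $A,D_A:\boldsymbol W_h\to\boldsymbol W_h'$ and $B:\boldsymbol W_h\to Q_h'$ be the operators of $a$, $a^D$, $b$, let $\boldsymbol D_h=D_A^{-1}B^T$, $\boldsymbol X=\boldsymbol W_h\times Q_h$, and $$\mathcal A=\begin{pmatrix}A&B^T\\-B&0\end{pmatrix},\qquad \mathcal B_D=\begin{pmatrix}A&0\\0&BD_A^{-1}B^T\end{pmatrix}^{-1},\qquad |||(\boldsymbol r,q)|||^2=a(\boldsymbol r,\boldsymbol r)+a^D(\boldsymbol D_hq,\boldsymbol D_hq),$$ $$\mathcal L(\boldsymbol w,p;\boldsymbol r,q)=a(\boldsymbol w,\boldsymbol r)+a^D(\boldsymbol D_hp,\boldsymbol r)+a^D(\boldsymbol D_hq,\boldsymbol w).$$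 Let $\kappa(T)=\|T\|\,\|T^{-1}\|$ with the operator norms induced by $|||\cdot|||$ on $\boldsymbol X$. **Theorem.** For all real $\sigma$ and $\tau$ there are constants $\alpha,\beta>0$, depending only on $\sigma$ and $\tau$, such that the following holds for all fractured media and meshes as above for which every cell $T$ of the subdomain meshes satisfies $\operatorname{diam}T\le\sigma\rho_T$, with $\rho_T$ the diameter of the largest ball inscribed in $T$, and all parameters $K,K_\nu,\gamma$ as above such that on each subdomain the largest eigenvalue of $K$ is at most $\tau$ times the smallest one ($\tau=1$ if $K$ is a scalar multiple of the identity on each subdomain): 1. $A$, $D_A$, $BD_A^{-1}B^T$ and $\mathcal A$ are invertible, and $|||\cdot|||$ is positive definite. 2. $|\mathcal L(\boldsymbol x;\boldsymbol y)|\le\alpha\,|||\boldsymbol x|||\,|||\boldsymbol y|||$ for all $\boldsymbol x,\boldsymbol y\in\boldsymbol X$, and $\displaystyle\inf_{\boldsymbol y\ne0}\sup_{\boldsymbol x\neq0}\frac{\mathcal L(\boldsymbol x;\boldsymbol y)}{|||\boldsymbol x|||\,|||\boldsymbol y|||}\ge\beta$. 3. $\kappa(\mathcal B_D\mathcal A)\le\alpha/\beta$;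 moreover $\kappa(\mathcal B_D\mathcal A)\le\alpha'/\beta'$ for any constants $\alpha',\beta'>0$ that satisfy the two inequalities in 2 in place of $\alpha,\beta$. In particular the bound is independent of the mesh size $h$, of the interface meshes, of the size and the jumps of $K$, and of $K_\nu$ and $\gamma$. -/

import Mathlib

open MeasureTheory

namespace MixedDim

noncomputable section

/-- The Euclidean space `ℝⁿ`. -/
abbrev E (n : ℕ) : Type := EuclideanSpace ℝ (Fin n)

/-! ### Simplices -/

/-- The closed simplex as a set. -/
def body {n d : ℕ} (s : Affine.Simplex ℝ (E n) d) : Set (E n) :=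
  convexHull ℝ (Set.range s.points)

/-- The facet of a simplex opposite to the vertex `k`, as a closed set
(empty for a simplex of dimension `0`). -/
def facet {n d : ℕ} (s : Affine.Simplex ℝ (E n) d) (k : Fin (d + 1)) : Set (E n) :=
  convexHull ℝ (s.points '' {k}ᶜ)

/-- The distance of the vertex `k` from the plane of the opposite facet. -/
def facetHeight {n d : ℕ} (s : Affine.Simplex ℝ (E n) d) (k : Fin (d + 1)) : ℝ :=
  if h : d = 0 then 0 else
    haveI : NeZero d := ⟨h⟩
    s.height k

/-- The unit normal of the facet opposite to the vertex `k`, tangential to the simplex and pointing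
out of it. -/
def outwardNormal {n d : ℕ} (s : Affine.Simplex ℝ (E n) d) (k : Fin (d + 1)) : E n :=
  if h : d = 0 then 0 else
    haveI : NeZero d := ⟨h⟩
    (s.height k)⁻¹ • (s.altitudeFoot k - s.points k)

/-- The barycentre of the facet opposite to the vertex `k`. -/
def facetBarycenter {n d : ℕ} (s : Affine.Simplex ℝ (E n) d) (k : Fin (d + 1)) : E n :=
  (d : ℝ)⁻¹ • ∑ j ∈ Finset.univ.erase k, s.points j

/-! ### Lowest order Raviart–Thomas fields on one simplex

A tangential vector field on a simplex whose plane has direction `D` is a map into `D`; it is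
extended to `ℝⁿ` so as to be constant along the normal directions of the plane. -/

/-- `RT₀` on a plane with direction `D` through `p`: the fields `x ↦ a + b (x - p)`. -/
def rtPoly {n : ℕ} (D : Submodule ℝ (E n)) (p : E n) : Submodule ℝ (E n → D) where
  carrier := {v | ∃ (a : D) (b : ℝ), ∀ x, v x = a + b • D.orthogonalProjectionOnto (x - p)}
  zero_mem' := ⟨0, 0, fun x => by simp⟩
  add_mem' := by
    rintro u v ⟨a, b, h⟩ ⟨a', b', h'⟩
    refine ⟨a + a', b + b', fun x => ?_⟩
    rw [Pi.add_apply, h, h', add_smul]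
    abel
  smul_mem' := by
    rintro c v ⟨a, b, h⟩
    refine ⟨c • a, c * b, fun x => ?_⟩
    rw [Pi.smul_apply, h, smul_add, mul_smul]

/-- The divergence of a tangential field: the trace of the tangential derivative. -/
def tangentialDiv {n : ℕ} {D : Submodule ℝ (E n)} (v : E n → D) (x : E n) : ℝ :=
  LinearMap.trace ℝ D ((fderiv ℝ v x).toLinearMap ∘ₗ D.subtype)

/-- The `RT₀` basis function of the facet opposite to the vertex `k`: its normal component is `1`
on that facet and `0` on the other ones. -/
def rtBasis {n d : ℕ} (D : Submodule ℝ (E n)) (s : Affine.Simplex ℝ (E n) d) (k : Fin (d + 1)) :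
    E n → D :=
  fun x => (facetHeight s k)⁻¹ • D.orthogonalProjectionOnto (x - s.points k)

/-! ### Fractured domains and their meshes -/

/-- The role of a facet of a cell. `C`, `F`, `I` are the types of cells, of facets of a cell, and of
interfaces. -/
inductive FacetKind (C F I : Type) : Type
  /-- shared with the facet `k'` of the cell `c'` of the same subdomain -/
  | interior (c' : C) (k' : F)
  /-- on the part of the outer boundary where the pressure is prescribed -/
  | dirichlet
  /-- no flow: on the rest of the outer boundary, or at an immersed tip of a fracture -/
  | neumann
  /-- on the interface `e` to a subdomain of one dimension less -/
  | mortar (e : I)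

/-- A fractured porous medium in `ℝⁿ` whose fractures, fracture intersections, etc. are flat,
decomposed into subdomains of dimensions `0, …, n`, with simplicial meshes of the subdomains and
independent simplicial meshes of the interfaces. The closure of a subdomain is the union of its
cells. An interface is one side of a lower-dimensional subdomain `low`, seen from an adjacent
subdomain `up` of one dimension more. -/
structure MixedDimMesh (n : ℕ) where
  /-- the subdomains `Ω_i^d`, of all dimensions `d` -/
  Sub : Type
  [subFintype : Fintype Sub]
  dim : Sub → ℕ
  dim_le : ∀ i, dim i ≤ n
  /-- the elements of the mesh of a subdomain -/
  Cell : Sub → Type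
  [cellFintype : ∀ i, Fintype (Cell i)]
  [cellNonempty : ∀ i, Nonempty (Cell i)]
  simplex : ∀ i, Cell i → Affine.Simplex ℝ (E n) (dim i)
  /-- the plane that contains a subdomain -/
  plane : Sub → AffineSubspace ℝ (E n)
  affineSpan_simplex : ∀ i c, affineSpan ℝ (Set.range (simplex i c).points) = plane i
  /-- cells do not overlap, and the subdomains are disjoint -/
  disjoint_cells : Pairwise fun s t : Σ i, Cell i =>
    Disjoint (intrinsicInterior ℝ (body (simplex s.1 s.2)))
      (intrinsicInterior ℝ (body (simplex t.1 t.2)))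
  /-- the interfaces `Γ_ij^d` -/
  Iface : Type
  [ifaceFintype : Fintype Iface]
  up : Iface → Sub
  low : Iface → Sub
  dim_up : ∀ e, dim (up e) = dim (low e) + 1
  /-- the role of the facet opposite to a vertex of a cell -/
  kind : ∀ i, Cell i → Fin (dim i + 1) → FacetKind (Cell i) (Fin (dim i + 1)) Iface
  /-- a point has no facets; this fixes a meaningless value -/
  kind_point : ∀ i c k, dim i = 0 → kind i c k = .neumann
  interior_symm : ∀ i c k c' k', kind i c k = .interior c' k' → kind i c' k' = .interior c k
  interior_shared : ∀ i c k c' k', kind i c k = .interior c' k' →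
    c ≠ c' ∧ facet (simplex i c) k = facet (simplex i c') k'
  /-- an interior facet lies inside its subdomain, so it meets no subdomain of lower dimension -/
  interior_avoids : ∀ i c k c' k', kind i c k = .interior c' k' → ∀ j, dim j < dim i →
    ∀ c'' : Cell j, Disjoint (intrinsicInterior ℝ (facet (simplex i c) k)) (body (simplex j c''))
  /-- Dirichlet facets lie on the boundary of the medium -/
  dirichlet_boundary : ∀ i c k, kind i c k = .dirichlet →
    facet (simplex i c) k ⊆
      frontier (⋃ (j : Sub) (_ : dim j = n) (c' : Cell j), body (simplex j c'))
  mortar_up : ∀ i c k e, kind i c k = .mortar e → i = up e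
  /-- the facets on an interface cover the lower-dimensional subdomain … -/
  mortar_cover : ∀ e,
    (⋃ (c : Cell (up e)) (k) (_ : kind (up e) c k = .mortar e), facet (simplex (up e) c) k) =
      ⋃ c' : Cell (low e), body (simplex (low e) c')
  /-- … once -/
  mortar_disjoint : ∀ e, Pairwise fun s t : {s : Cell (up e) × Fin (dim (up e) + 1) //
      kind (up e) s.1 s.2 = .mortar e} =>
    Disjoint (intrinsicInterior ℝ (facet (simplex (up e) s.1.1) s.1.2))
      (intrinsicInterior ℝ (facet (simplex (up e) t.1.1) t.1.2))
  /-- the elements of the mesh of an interface -/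
  MCell : Iface → Type
  [mcellFintype : ∀ e, Fintype (MCell e)]
  msimplex : ∀ e, MCell e → Affine.Simplex ℝ (E n) (dim (low e))
  msimplex_cover : ∀ e,
    (⋃ m : MCell e, body (msimplex e m)) = ⋃ c' : Cell (low e), body (simplex (low e) c')
  msimplex_disjoint : ∀ e, Pairwise fun m m' : MCell e =>
    Disjoint (intrinsicInterior ℝ (body (msimplex e m)))
      (intrinsicInterior ℝ (body (msimplex e m')))
  /-- every subdomain is connected: any two of its cells are joined by a chain of cells in which
  neighbours share an interior facet -/
  sub_connected : ∀ i (c c' : Cell i),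
    Relation.EqvGen (fun a b => ∃ k k', kind i a k = .interior b k') c c'
  /-- the medium is connected: any two subdomains are joined by a chain of interfaces -/
  connected : ∀ i j, Relation.EqvGen (fun a b => ∃ e, up e = a ∧ low e = b) i j
  /-- the Dirichlet part of the boundary of the medium has positive `(n-1)`-dimensional measure -/
  exists_dirichlet : ∃ i c k, dim i = n ∧ kind i c k = .dirichlet

attribute [instance] MixedDimMesh.subFintype MixedDimMesh.cellFintype MixedDimMesh.cellNonempty
  MixedDimMesh.ifaceFintype MixedDimMesh.mcellFintype

/-- The directions tangential to a subdomain. -/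
abbrev MixedDimMesh.dir {n : ℕ} (M : MixedDimMesh n) (i : M.Sub) : Submodule ℝ (E n) :=
  (M.plane i).direction

/-- Shape regularity with constant `σ`: the diameter of every cell of every subdomain is at most `σ`
times the diameter `2 r` of some ball inscribed in the cell. -/
def MixedDimMesh.ShapeRegular {n : ℕ} (M : MixedDimMesh n) (σ : ℝ) : Prop :=
  ∀ i (c : M.Cell i), ∃ z ∈ M.plane i, ∃ r : ℝ, 0 < r ∧
    Metric.closedBall z r ∩ (M.plane i : Set (E n)) ⊆ body (M.simplex i c) ∧
    Metric.diam (body (M.simplex i c)) ≤ σ * (2 * r)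

/-- The physical parameters. The tangential permeability `K` is a symmetric positive definite tensor,
constant on each subdomain; the normal permeability `Kν` is a measurable function on the interfaces,
bounded above and below by positive constants; `γ` is a positive constant on each interface. -/
structure Params {n : ℕ} (M : MixedDimMesh n) where
  K : ∀ i, M.dir i ≃ₗ[ℝ] M.dir i
  K_symm : ∀ i (u v : M.dir i), inner ℝ (K i u) v = inner ℝ u (K i v)
  K_pos : ∀ i (v : M.dir i), v ≠ 0 → 0 < inner ℝ (K i v) v
  Kν : M.Iface → E n → ℝ
  Kν_measurable : ∀ e, Measurable (Kν e)
  Kν_bounds : ∀ e, ∃ a b : ℝ, 0 < a ∧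
    ∀ m : M.MCell e, ∀ x ∈ body (M.msimplex e m), a ≤ Kν e x ∧ Kν e x ≤ b
  γ : M.Iface → ℝ
  γ_pos : ∀ e, 0 < γ e

/-- On each subdomain the ratio of the extreme eigenvalues of `K` is at most `τ`. -/
def Params.AnisotropyLE {n : ℕ} {M : MixedDimMesh n} (P : Params M) (τ : ℝ) : Prop :=
  ∀ i, ∃ κ : ℝ, 0 < κ ∧ ∀ v : M.dir i,
    κ * ‖v‖ ^ 2 ≤ inner ℝ (P.K i v) v ∧ inner ℝ (P.K i v) v ≤ τ * κ * ‖v‖ ^ 2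

/-! ### The discrete spaces -/

section Spaces

variable {n : ℕ} (M : MixedDimMesh n)

/-- Elementwise given tangential vector fields on all subdomains. -/
abbrev Field : Type := ∀ i, M.Cell i → E n → M.dir i

variable {M} in
/-- The outward normal component of a field at the facet `k` of the cell `c`. -/
def normalTrace (v : Field M) (i : M.Sub) (c : M.Cell i) (k : Fin (M.dim i + 1)) (x : E n) : ℝ :=
  inner ℝ (v i c x : E n) (outwardNormal (M.simplex i c) k)

/-- `V_h`: elementwise `RT₀` fields whose normal components are continuous across interior facets
and vanish on no-flow facets. There is no condition on Dirichlet facets and on interfaces. -/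
def V : Submodule ℝ (Field M) where
  carrier := {v |
    (∀ i c, v i c ∈ rtPoly (M.dir i) ((M.simplex i c).points 0)) ∧
    (∀ i c k c' k', M.kind i c k = .interior c' k' → ∀ x ∈ facet (M.simplex i c) k,
      normalTrace v i c k x + normalTrace v i c' k' x = 0) ∧
    (∀ i c k, M.kind i c k = .neumann → ∀ x ∈ facet (M.simplex i c) k,
      normalTrace v i c k x = 0)}
  zero_mem' := by
    refine ⟨fun i c => Submodule.zero_mem _, ?_, ?_⟩ <;> intros <;> simp [normalTrace]
  add_mem' := by
    rintro u v ⟨h1, h2, h3⟩ ⟨h1', h2', h3'⟩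
    refine ⟨fun i c => Submodule.add_mem _ (h1 i c) (h1' i c), ?_, ?_⟩
    · intro i c k c' k' hk x hx
      have a := h2 i c k c' k' hk x hx
      have b := h2' i c k c' k' hk x hx
      simp only [normalTrace, Pi.add_apply, Submodule.coe_add, inner_add_left] at a b ⊢
      linarith
    · intro i c k hk x hx
      have a := h3 i c k hk x hx
      have b := h3' i c k hk x hx
      simp only [normalTrace, Pi.add_apply, Submodule.coe_add, inner_add_left] at a b ⊢
      linarith
  smul_mem' := by
    rintro r v ⟨h1, h2, h3⟩
    refine ⟨fun i c => Submodule.smul_mem _ _ (h1 i c), ?_, ?_⟩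
    · intro i c k c' k' hk x hx
      have a := h2 i c k c' k' hk x hx
      simp only [normalTrace, Pi.smul_apply, Submodule.coe_smul, real_inner_smul_left] at a ⊢
      rw [← mul_add, a, mul_zero]
    · intro i c k hk x hx
      have a := h3 i c k hk x hx
      simp only [normalTrace, Pi.smul_apply, Submodule.coe_smul, real_inner_smul_left] at a ⊢
      rw [a, mul_zero]

/-- `V_{0h}`: the fields of `V_h` whose normal components vanish on all interfaces. -/
def V0 : Submodule ℝ (V M) where
  carrier := {v | ∀ i c k e, M.kind i c k = .mortar e → ∀ x ∈ facet (M.simplex i c) k,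
    normalTrace v.1 i c k x = 0}
  zero_mem' := by simp [normalTrace]
  add_mem' := by
    intro u v h h' i c k e hk x hx
    have a := h i c k e hk x hx
    have b := h' i c k e hk x hx
    simp only [normalTrace, Submodule.coe_add, Pi.add_apply, inner_add_left] at a b ⊢
    linarith
  smul_mem' := by
    intro r v h i c k e hk x hx
    have a := h i c k e hk x hx
    simp only [normalTrace, Submodule.coe_smul, Pi.smul_apply, real_inner_smul_left] at a ⊢
    rw [a, mul_zero]

/-- `Λ_h`: piecewise constants on the meshes of the interfaces. -/
abbrev Lam : Type := ∀ e, M.MCell e → ℝ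

/-- `Q_h`: piecewise constants on the meshes of the subdomains. -/
abbrev Q : Type := ∀ i, M.Cell i → ℝ

/-- `W_h = V_{0h} × Λ_h`. -/
abbrev W : Type := V0 M × Lam M

/-- `X = W_h × Q_h`. -/
abbrev X : Type := W M × Q M

variable {M}

/-- A mortar variable as a function on the interface `e` (zero off the interface). -/
def mortarFun (μ : Lam M) (e : M.Iface) (x : E n) : ℝ :=
  ∑ m, (body (M.msimplex e m)).indicator (fun _ => μ e m) x

open Classical in
/-- The jump `⟦μ⟧` on the subdomain `i`: minus the sum over the interfaces that lie on `i`. -/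
def jump (μ : Lam M) (i : M.Sub) (x : E n) : ℝ :=
  -∑ e, if M.low e = i then mortarFun μ e x else 0

/-- The value on the facet `f ⊆ e` of the `L²`-projection `Π̂_h μ` of a mortar variable onto the
facetwise constants (the normal components of `V_h` on the interface): the mean of `μ` over `f`. -/
def proj (μ : Lam M) (e : M.Iface) (f : Set (E n)) : ℝ :=
  ∑ m, μ e m * ((μHE[M.dim (M.low e)] : Measure (E n)).real (f ∩ body (M.msimplex e m)) /
    (μHE[M.dim (M.low e)] : Measure (E n)).real f)

/-- The normal component on the facet `k` of the cell `c` of the extension of a mortar variable. -/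
def extCoeff (μ : Lam M) (i : M.Sub) (c : M.Cell i) (k : Fin (M.dim i + 1)) : ℝ :=
  match M.kind i c k with
  | .mortar e => proj μ e (facet (M.simplex i c) k)
  | _ => 0

/-- The extension `R_h μ` as a field. -/
def extField (μ : Lam M) : Field M :=
  fun i c x => ∑ k, extCoeff μ i c k • rtBasis (M.dir i) (M.simplex i c) k x

/-! ### The extension operator -/

theorem facet_subset_body {d : ℕ} (s : Affine.Simplex ℝ (E n) d) (k : Fin (d + 1)) :
    facet s k ⊆ body s :=
  convexHull_mono (Set.image_subset_range _ _)

theorem body_subset_plane (i : M.Sub) (c : M.Cell i) :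
    body (M.simplex i c) ⊆ (M.plane i : Set (E n)) := by
  rw [← M.affineSpan_simplex i c]
  exact convexHull_subset_affineSpan _

theorem inner_sub_outwardNormal {d : ℕ} (s : Affine.Simplex ℝ (E n) d) (j k : Fin (d + 1))
    {x : E n} (hx : x ∈ facet s j) :
    inner ℝ (x - s.points k) (outwardNormal s j) = if k = j then facetHeight s j else 0 := by
  by_cases hd : d = 0
  · exfalso
    subst hd
    have : ({j}ᶜ : Set (Fin (0 + 1))) = ∅ := by
      ext a
      have h1 := a.2
      have h2 := j.2
      have : a = j := Fin.ext (by omega)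
      simp [this]
    simp [facet, this] at hx
  · have : NeZero d := ⟨hd⟩
    have key : ∀ y ∈ affineSpan ℝ (s.points '' {j}ᶜ),
        inner ℝ (y - s.altitudeFoot j) (s.altitudeFoot j - s.points j) = 0 := by
      intro y hy
      refine Submodule.inner_right_of_mem_orthogonal
        (K := vectorSpan ℝ (s.points '' {j}ᶜ))
        (vsub_mem_vectorSpan_of_mem_affineSpan_of_mem_affineSpan hy
          (Affine.Simplex.altitudeFoot_mem_affineSpan_image_compl _ _)) ?_
      rw [← direction_affineSpan, ← Affine.Simplex.range_faceOpposite_points]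
      exact EuclideanGeometry.orthogonalProjection_vsub_mem_direction_orthogonal _ _
    have hx' := key x (convexHull_subset_affineSpan _ hx)
    have hh : s.height j ≠ 0 := (s.height_pos j).ne'
    simp only [outwardNormal, facetHeight, hd, dif_neg, not_false_eq_true, real_inner_smul_right]
    split_ifs with hk
    · subst hk
      have e1 : x - s.points k = (x - s.altitudeFoot k) + (s.altitudeFoot k - s.points k) := by
        abel
      rw [e1, inner_add_left, hx', real_inner_self_eq_norm_sq, ← dist_eq_norm, dist_comm]
      change (s.height k)⁻¹ * (0 + s.height k ^ 2) = s.height k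
      field_simp
      ring
    · have e1 : x - s.points k = (x - s.altitudeFoot j) - (s.points k - s.altitudeFoot j) := by
        abel
      rw [e1, inner_sub_left, hx',
        key (s.points k) (mem_affineSpan ℝ (Set.mem_image_of_mem _ hk))]
      simp

/-- The normal components of the basis functions. -/
theorem inner_rtBasis (i : M.Sub) (c : M.Cell i) (j k : Fin (M.dim i + 1)) {x : E n}
    (hx : x ∈ facet (M.simplex i c) j) :
    inner ℝ (rtBasis (M.dir i) (M.simplex i c) k x : E n) (outwardNormal (M.simplex i c) j) =
      if k = j then 1 else 0 := by
  have hm : x - (M.simplex i c).points k ∈ M.dir i := by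
    refine AffineSubspace.vsub_mem_direction
      (body_subset_plane i c (facet_subset_body _ _ hx)) ?_
    exact body_subset_plane i c (subset_convexHull ℝ _ (Set.mem_range_self _))
  have hp : ((M.dir i).orthogonalProjectionOnto (x - (M.simplex i c).points k) : E n) =
      x - (M.simplex i c).points k :=
    Submodule.starProjection_eq_self_iff.2 hm
  have h0 : M.dim i ≠ 0 := by
    intro h0
    have : ({j}ᶜ : Set (Fin (M.dim i + 1))) = ∅ := by
      ext a
      have h1 := a.2
      have h2 := j.2
      have : a = j := Fin.ext (by omega)
      simp [this]
    simp [facet, this] at hx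
  rw [rtBasis, Submodule.coe_smul, hp, real_inner_smul_left, inner_sub_outwardNormal _ _ _ hx]
  split_ifs with hk
  · subst hk
    have : NeZero (M.dim i) := ⟨h0⟩
    have : facetHeight (M.simplex i c) k ≠ 0 := by
      simp only [facetHeight, h0, dif_neg, not_false_eq_true]
      exact (Affine.Simplex.height_pos _ _).ne'
    exact inv_mul_cancel₀ this
  · simp

theorem rtBasis_mem (D : Submodule ℝ (E n)) {d : ℕ} (s : Affine.Simplex ℝ (E n) d)
    (k : Fin (d + 1)) : rtBasis D s k ∈ rtPoly D (s.points 0) := by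
  refine ⟨(facetHeight s k)⁻¹ • D.orthogonalProjectionOnto (s.points 0 - s.points k),
    (facetHeight s k)⁻¹, fun x => ?_⟩
  rw [rtBasis, ← smul_add, ← map_add]
  congr 2
  abel

/-- `R_h μ` has the normal component `Π̂_h μ` on the interfaces and `0` on all other facets. -/
theorem normalTrace_extField (μ : Lam M) (i : M.Sub) (c : M.Cell i) (k : Fin (M.dim i + 1))
    {x : E n} (hx : x ∈ facet (M.simplex i c) k) :
    normalTrace (extField μ) i c k x = extCoeff μ i c k := by
  simp only [normalTrace, extField, Submodule.coe_sum, Submodule.coe_smul, sum_inner,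
    real_inner_smul_left, inner_rtBasis i c k _ hx]
  simp

theorem extField_mem (μ : Lam M) : extField μ ∈ V M := by
  refine ⟨fun i c => ?_, fun i c k c' k' hk x hx => ?_, fun i c k hk x hx => ?_⟩
  · have : extField μ i c = ∑ k, extCoeff μ i c k • rtBasis (M.dir i) (M.simplex i c) k := by
      ext x
      simp [extField]
    rw [this]
    exact Submodule.sum_mem _ fun k _ => Submodule.smul_mem _ _ (rtBasis_mem _ _ _)
  · have hx' : x ∈ facet (M.simplex i c') k' := (M.interior_shared i c k c' k' hk).2 ▸ hx
    rw [normalTrace_extField μ i c k hx, normalTrace_extField μ i c' k' hx']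
    simp [extCoeff, hk, M.interior_symm i c k c' k' hk]
  · rw [normalTrace_extField μ i c k hx]
    simp [extCoeff, hk]

variable (M) in
/-- The discrete extension operator `R_h : Λ_h → V_h`. -/
def ext : Lam M →ₗ[ℝ] V M where
  toFun μ := ⟨extField μ, extField_mem μ⟩
  map_add' μ μ' := by
    have h : ∀ i c k, extCoeff (μ + μ') i c k = extCoeff μ i c k + extCoeff μ' i c k := by
      intro i c k
      unfold extCoeff
      cases M.kind i c k <;> simp [proj, add_mul, Finset.sum_add_distrib]
    refine Subtype.ext ?_
    funext i c x
    simp [extField, h, add_smul, Finset.sum_add_distrib]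
  map_smul' r μ := by
    have h : ∀ i c k, extCoeff (r • μ) i c k = r * extCoeff μ i c k := by
      intro i c k
      unfold extCoeff
      cases M.kind i c k <;> simp [proj, mul_assoc, Finset.mul_sum]
    refine Subtype.ext ?_
    funext i c x
    simp [extField, h, mul_smul, Finset.smul_sum]

variable (M) in
/-- The total flux `v_{0h} + R_h μ_h` of an element `[v_{0h}, μ_h]` of `W_h`. -/
def total : W M →ₗ[ℝ] V M :=
  (V0 M).subtype.coprod (ext M)

/-! ### Integrability -/

theorem isCompact_body {d : ℕ} (s : Affine.Simplex ℝ (E n) d) : IsCompact (body s) :=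
  (Set.finite_range _).isCompact_convexHull ℝ

theorem measure_lt_top_of_subset (A : AffineSubspace ℝ (E n)) {d : ℕ}
    (hd : Module.finrank ℝ A.direction = d) {S : Set (E n)} (hS : Bornology.IsBounded S)
    (hSA : S ⊆ (A : Set (E n))) : (μHE[d] : Measure (E n)) S < ⊤ := by
  rcases S.eq_empty_or_nonempty with rfl | ⟨p, hp⟩
  · simp
  let T : Set A.direction := (fun v : A.direction => (v : E n) + p) ⁻¹' S
  have hiso : Isometry (fun v : A.direction => (v : E n) + p) := by
    refine Isometry.of_dist_eq fun a b => ?_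
    simp [dist_eq_norm]
  have hT : (fun v : A.direction => (v : E n) + p) '' T = S := by
    refine Set.image_preimage_eq_of_subset fun x hx => ?_
    exact ⟨⟨x - p, AffineSubspace.vsub_mem_direction (hSA hx) (hSA hp)⟩, by simp⟩
  have hTb : Bornology.IsBounded T := by
    rw [← hT] at hS
    exact hiso.antilipschitz.isBounded_preimage hS |>.subset (Set.subset_preimage_image _ _)
  rw [← hT, hiso.euclideanHausdorffMeasure_image, ← hd]
  exact hTb.measure_lt_top

theorem measure_body_lt_top {d : ℕ} (s : Affine.Simplex ℝ (E n) d) :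
    (μHE[d] : Measure (E n)) (body s) < ⊤ := by
  refine measure_lt_top_of_subset (affineSpan ℝ (Set.range s.points)) ?_
    (isCompact_body s).isBounded (convexHull_subset_affineSpan _)
  rw [direction_affineSpan]
  exact s.independent.finrank_vectorSpan (by simp)

theorem integrableOn_body {d : ℕ} (s : Affine.Simplex ℝ (E n) d) {f : E n → ℝ}
    (hf : Continuous f) : IntegrableOn f (body s) μHE[d] := by
  obtain ⟨C, hC⟩ := (isCompact_body s).exists_bound_of_continuousOn hf.continuousOn
  refine IntegrableOn.of_bound (measure_body_lt_top s) hf.aestronglyMeasurable C ?_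
  exact (ae_restrict_iff' (isCompact_body s).measurableSet).2 (Filter.Eventually.of_forall hC)

theorem integrableOn_mortarFun {d : ℕ} (s : Affine.Simplex ℝ (E n) d) (μ : Lam M) (e : M.Iface) :
    IntegrableOn (mortarFun μ e) (body s) μHE[d] := by
  unfold mortarFun
  refine integrable_finsetSum _ fun m _ => ?_
  refine IntegrableOn.indicator ?_ (isCompact_body _).measurableSet
  exact integrableOn_body s continuous_const

theorem integrableOn_jump {d : ℕ} (s : Affine.Simplex ℝ (E n) d) (μ : Lam M) (i : M.Sub) :
    IntegrableOn (jump μ i) (body s) μHE[d] := by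
  unfold jump
  refine Integrable.neg (integrable_finsetSum _ fun e _ => ?_)
  split_ifs
  · exact integrableOn_mortarFun s μ e
  · exact integrable_zero _ _ _

/-- The projection is the `L²`-projection: `Π̂_h μ - μ` is orthogonal to the constants on every
facet on an interface. -/
theorem setIntegral_proj_sub (μ : Lam M) (e : M.Iface) (c : M.Cell (M.up e))
    (k : Fin (M.dim (M.up e) + 1)) :
    ∫ x in facet (M.simplex (M.up e) c) k, (proj μ e (facet (M.simplex (M.up e) c) k) -
      mortarFun μ e x) ∂μHE[M.dim (M.low e)] = 0 := by
  set f := facet (M.simplex (M.up e) c) k with hf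
  have hd : M.dim (M.up e) ≠ 0 := by rw [M.dim_up]; omega
  have : NeZero (M.dim (M.up e)) := ⟨hd⟩
  have hfc : IsCompact f :=
    ((Set.toFinite _).image _).isCompact_convexHull ℝ
  have hfin : (μHE[M.dim (M.low e)] : Measure (E n)) f < ⊤ := by
    refine measure_lt_top_of_subset
      (affineSpan ℝ (Set.range ((M.simplex (M.up e) c).faceOpposite k).points)) ?_
      hfc.isBounded ?_
    · rw [direction_affineSpan]
      refine ((M.simplex (M.up e) c).faceOpposite k).independent.finrank_vectorSpan ?_
      have := M.dim_up e
      simp only [Fintype.card_fin]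
      omega
    · rw [Affine.Simplex.range_faceOpposite_points]
      exact convexHull_subset_affineSpan _
  have hm : ∀ m, MeasurableSet (body (M.msimplex e m)) := fun m =>
    (isCompact_body _).measurableSet
  have hi : ∀ m, IntegrableOn ((body (M.msimplex e m)).indicator (fun _ => μ e m)) f
      μHE[M.dim (M.low e)] := fun m =>
    IntegrableOn.indicator (integrableOn_const hfin.ne) (hm m)
  have hsum : ∫ x in f, mortarFun μ e x ∂μHE[M.dim (M.low e)] =
      ∑ m, μ e m * (μHE[M.dim (M.low e)] : Measure (E n)).real (f ∩ body (M.msimplex e m)) := by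
    unfold mortarFun
    rw [integral_finsetSum _ fun m _ => hi m]
    refine Finset.sum_congr rfl fun m _ => ?_
    rw [setIntegral_indicator (hm m), setIntegral_const, smul_eq_mul, mul_comm]
  have h1 : IntegrableOn (fun _ : E n => proj μ e f) f μHE[M.dim (M.low e)] :=
    integrableOn_const hfin.ne
  have h2 : IntegrableOn (mortarFun μ e) f μHE[M.dim (M.low e)] :=
    integrable_finsetSum _ fun m _ => hi m
  rw [integral_sub h1 h2, hsum,
    setIntegral_const, smul_eq_mul, proj, Finset.mul_sum, ← Finset.sum_sub_distrib]
  refine Finset.sum_eq_zero fun m _ => ?_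
  by_cases h0 : (μHE[M.dim (M.low e)] : Measure (E n)).real f = 0
  · have : (μHE[M.dim (M.low e)] : Measure (E n)).real (f ∩ body (M.msimplex e m)) = 0 :=
      le_antisymm (h0 ▸ measureReal_mono Set.inter_subset_left hfin.ne) measureReal_nonneg
    rw [h0, this]
    simp
  · field_simp
    ring

/-! ### Bilinear forms -/

theorem rtPoly_contDiff {D : Submodule ℝ (E n)} {p : E n} {v : E n → D} (hv : v ∈ rtPoly D p) :
    ContDiff ℝ 1 v := by
  obtain ⟨a, b, h⟩ := hv
  rw [funext h]
  fun_prop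

theorem V_contDiff (v : V M) (i : M.Sub) (c : M.Cell i) : ContDiff ℝ 1 (v.1 i c) :=
  rtPoly_contDiff (v.2.1 i c)

theorem V_differentiable (v : V M) (i : M.Sub) (c : M.Cell i) : Differentiable ℝ (v.1 i c) :=
  (V_contDiff v i c).differentiable (by norm_num)

variable (P : Params M)

theorem integrableOn_inner (u v : V M) (i : M.Sub) (c : M.Cell i) :
    IntegrableOn (fun x => (inner ℝ ((P.K i).symm (u.1 i c x)) (v.1 i c x) : ℝ))
      (body (M.simplex i c)) μHE[M.dim i] := by
  refine integrableOn_body _ ?_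
  have h1 : Continuous fun x => (P.K i).symm (u.1 i c x) :=
    ((P.K i).symm.toLinearMap.continuous_of_finiteDimensional).comp (V_contDiff u i c).continuous
  exact h1.inner (V_contDiff v i c).continuous

/-- `(K⁻¹ u, v)_Ω`. -/
def massForm : V M →ₗ[ℝ] V M →ₗ[ℝ] ℝ :=
  LinearMap.mk₂ ℝ (fun u v => ∑ i, ∑ c, ∫ x in body (M.simplex i c),
      (inner ℝ ((P.K i).symm (u.1 i c x)) (v.1 i c x) : ℝ) ∂μHE[M.dim i])
    (fun u u' v => by
      simp only [← Finset.sum_add_distrib]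
      refine Finset.sum_congr rfl fun i _ => Finset.sum_congr rfl fun c _ => ?_
      rw [← integral_add (integrableOn_inner P u v i c) (integrableOn_inner P u' v i c)]
      simp only [Submodule.coe_add, Pi.add_apply, map_add, inner_add_left])
    (fun r u v => by
      simp only [smul_eq_mul, Finset.mul_sum, ← integral_const_mul]
      simp only [Submodule.coe_smul, Pi.smul_apply, map_smul]
      refine Finset.sum_congr rfl fun i _ => Finset.sum_congr rfl fun c _ => ?_
      congr 1
      funext x
      exact real_inner_smul_left (F := M.dir i) _ _ _)
    (fun u v v' => by
      simp only [← Finset.sum_add_distrib]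
      refine Finset.sum_congr rfl fun i _ => Finset.sum_congr rfl fun c _ => ?_
      rw [← integral_add (integrableOn_inner P u v i c) (integrableOn_inner P u v' i c)]
      simp only [Submodule.coe_add, Pi.add_apply, inner_add_right])
    (fun r u v => by
      simp only [smul_eq_mul, Finset.mul_sum, ← integral_const_mul]
      simp only [Submodule.coe_smul, Pi.smul_apply, real_inner_smul_right])

theorem normalTrace_add (u v : Field M) (i : M.Sub) (c : M.Cell i) (k : Fin (M.dim i + 1))
    (x : E n) : normalTrace (u + v) i c k x = normalTrace u i c k x + normalTrace v i c k x := by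
  simp only [normalTrace, Pi.add_apply, Submodule.coe_add, inner_add_left]

theorem normalTrace_smul (r : ℝ) (v : Field M) (i : M.Sub) (c : M.Cell i)
    (k : Fin (M.dim i + 1)) (x : E n) :
    normalTrace (r • v) i c k x = r * normalTrace v i c k x := by
  simp only [normalTrace, Pi.smul_apply, Submodule.coe_smul, real_inner_smul_left]

/-- `(K⁻¹ u, v)_{D,Ω}`: the sum over all cells and all their facets `f` of
`(u ⬝ ν_f) (v ⬝ ν_f) (K⁻¹ φ_f, φ_f)`, where `u ⬝ ν_f` and `v ⬝ ν_f` are constant on `f`. -/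
def diagMassForm : V M →ₗ[ℝ] V M →ₗ[ℝ] ℝ :=
  LinearMap.mk₂ ℝ (fun u v => ∑ i, ∑ c, ∑ k,
      normalTrace u.1 i c k (facetBarycenter (M.simplex i c) k) *
      normalTrace v.1 i c k (facetBarycenter (M.simplex i c) k) *
      ∫ x in body (M.simplex i c),
        (inner ℝ ((P.K i).symm (rtBasis (M.dir i) (M.simplex i c) k x))
          (rtBasis (M.dir i) (M.simplex i c) k x) : ℝ) ∂μHE[M.dim i])
    (fun u u' v => by
      simp only [Submodule.coe_add, normalTrace_add, add_mul, Finset.sum_add_distrib])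
    (fun r u v => by
      simp only [Submodule.coe_smul, normalTrace_smul, smul_eq_mul, Finset.mul_sum, mul_assoc])
    (fun u v v' => by
      simp only [Submodule.coe_add, normalTrace_add, mul_add, add_mul, Finset.sum_add_distrib])
    (fun r u v => by
      simp only [Submodule.coe_smul, normalTrace_smul, smul_eq_mul, Finset.mul_sum]
      refine Finset.sum_congr rfl fun i _ => Finset.sum_congr rfl fun c _ =>
        Finset.sum_congr rfl fun k _ => ?_
      ring)

/-- `(γ Kν⁻¹ λ, μ)_Γ`. -/
def mortarForm : Lam M →ₗ[ℝ] Lam M →ₗ[ℝ] ℝ :=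
  LinearMap.mk₂ ℝ (fun l μ => ∑ e, ∑ m, ∫ x in body (M.msimplex e m),
      P.γ e * (P.Kν e x)⁻¹ * l e m * μ e m ∂μHE[M.dim (M.low e)])
    (fun u u' v => by
      simp only [integral_mul_const, Pi.add_apply, ← Finset.sum_add_distrib]
      refine Finset.sum_congr rfl fun i _ => Finset.sum_congr rfl fun c _ => ?_
      ring)
    (fun r u v => by
      simp only [integral_mul_const, Pi.smul_apply, smul_eq_mul, Finset.mul_sum]
      refine Finset.sum_congr rfl fun i _ => Finset.sum_congr rfl fun c _ => ?_
      ring)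
    (fun u v v' => by
      simp only [integral_mul_const, Pi.add_apply, ← Finset.sum_add_distrib]
      refine Finset.sum_congr rfl fun i _ => Finset.sum_congr rfl fun c _ => ?_
      ring)
    (fun r u v => by
      simp only [integral_mul_const, Pi.smul_apply, smul_eq_mul, Finset.mul_sum]
      refine Finset.sum_congr rfl fun i _ => Finset.sum_congr rfl fun c _ => ?_
      ring)

/-- `a([v_{0h}, μ_h], …)`. -/
def aForm : W M →ₗ[ℝ] W M →ₗ[ℝ] ℝ :=
  (massForm P).compl₁₂ (total M) (total M) +
    (mortarForm P).compl₁₂ (LinearMap.snd ℝ _ _) (LinearMap.snd ℝ _ _)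

/-- `a^D`. -/
def aDForm : W M →ₗ[ℝ] W M →ₗ[ℝ] ℝ :=
  (diagMassForm P).compl₁₂ (total M) (total M) +
    (mortarForm P).compl₁₂ (LinearMap.snd ℝ _ _) (LinearMap.snd ℝ _ _)

/-- The mixed-dimensional divergence `D ⬝ [v_{0h} + R_h μ_h, μ_h] = ∇ ⬝ (v_{0h} + R_h μ_h) + ⟦μ_h⟧`
on the cell `c` of the subdomain `i`. -/
def mixedDiv (r : W M) (i : M.Sub) (c : M.Cell i) (x : E n) : ℝ :=
  tangentialDiv ((total M r).1 i c) x + jump r.2 i x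

theorem tangentialDiv_add {D : Submodule ℝ (E n)} {u v : E n → D} (hu : Differentiable ℝ u)
    (hv : Differentiable ℝ v) (x : E n) :
    tangentialDiv (u + v) x = tangentialDiv u x + tangentialDiv v x := by
  simp only [tangentialDiv]
  rw [fderiv_add (hu x) (hv x), ← map_add]
  rfl

theorem tangentialDiv_smul {D : Submodule ℝ (E n)} {v : E n → D} (r : ℝ)
    (hv : Differentiable ℝ v) (x : E n) :
    tangentialDiv (r • v) x = r * tangentialDiv v x := by
  simp only [tangentialDiv]
  rw [fderiv_const_smul (hv x), ← smul_eq_mul, ← map_smul]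
  rfl

theorem jump_add (l μ : Lam M) (i : M.Sub) (x : E n) :
    jump (l + μ) i x = jump l i x + jump μ i x := by
  have h : ∀ e, mortarFun (l + μ) e x = mortarFun l e x + mortarFun μ e x := by
    intro e
    simp only [mortarFun, ← Finset.sum_add_distrib, Pi.add_apply]
    refine Finset.sum_congr rfl fun m _ => ?_
    by_cases hx : x ∈ body (M.msimplex e m) <;> simp [hx]
  simp only [jump, h, ← neg_add, ← Finset.sum_add_distrib]
  congr 1
  refine Finset.sum_congr rfl fun m _ => ?_
  split_ifs <;> simp

theorem jump_smul (r : ℝ) (μ : Lam M) (i : M.Sub) (x : E n) :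
    jump (r • μ) i x = r * jump μ i x := by
  have h : ∀ e, mortarFun (r • μ) e x = r * mortarFun μ e x := by
    intro e
    simp only [mortarFun, Finset.mul_sum, Pi.smul_apply]
    refine Finset.sum_congr rfl fun m _ => ?_
    by_cases hx : x ∈ body (M.msimplex e m) <;> simp [hx]
  simp only [jump, h, mul_neg, Finset.mul_sum]
  congr 1
  refine Finset.sum_congr rfl fun m _ => ?_
  split_ifs <;> simp

theorem mixedDiv_add (r s : W M) (i : M.Sub) (c : M.Cell i) (x : E n) :
    mixedDiv (r + s) i c x = mixedDiv r i c x + mixedDiv s i c x := by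
  have h := tangentialDiv_add (V_differentiable (total M r) i c)
    (V_differentiable (total M s) i c) x
  simp only [mixedDiv, map_add, Submodule.coe_add, Pi.add_apply, Prod.snd_add, jump_add, h]
  ring

theorem mixedDiv_smul (t : ℝ) (r : W M) (i : M.Sub) (c : M.Cell i) (x : E n) :
    mixedDiv (t • r) i c x = t * mixedDiv r i c x := by
  have h := tangentialDiv_smul t (V_differentiable (total M r) i c) x
  have h2 : jump (t • r).2 i x = t * jump r.2 i x := jump_smul t r.2 i x
  simp only [mixedDiv, map_smul, Submodule.coe_smul, Pi.smul_apply, h, h2]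
  ring

theorem integrableOn_mixedDiv (r : W M) (i : M.Sub) (c : M.Cell i) :
    IntegrableOn (mixedDiv r i c) (body (M.simplex i c)) μHE[M.dim i] := by
  refine Integrable.add (integrableOn_body _ ?_) (integrableOn_jump _ _ _)
  have h1 : Continuous (fderiv ℝ ((total M r).1 i c)) :=
    (V_contDiff (total M r) i c).continuous_fderiv (by norm_num)
  let L : (E n →L[ℝ] M.dir i) →ₗ[ℝ] ℝ :=
    { toFun := fun T => LinearMap.trace ℝ (M.dir i) (T.toLinearMap ∘ₗ (M.dir i).subtype)
      map_add' := fun S T => by rw [← map_add]; rfl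
      map_smul' := fun t T => by rw [RingHom.id_apply, ← map_smul]; rfl }
  exact L.continuous_of_finiteDimensional.comp h1

variable (M) in
/-- `b([v_{0h}, μ_h], p_h) = -(p_h, D ⬝ [v_{0h} + R_h μ_h, μ_h])_Ω`. -/
def bForm : W M →ₗ[ℝ] Q M →ₗ[ℝ] ℝ :=
  LinearMap.mk₂ ℝ (fun r p => -∑ i, ∑ c, ∫ x in body (M.simplex i c),
      p i c * mixedDiv r i c x ∂μHE[M.dim i])
    (fun r s p => by
      simp only [integral_const_mul, ← neg_add, ← Finset.sum_add_distrib]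
      congr 1
      refine Finset.sum_congr rfl fun i _ => Finset.sum_congr rfl fun c _ => ?_
      rw [← mul_add, ← integral_add (integrableOn_mixedDiv r i c) (integrableOn_mixedDiv s i c)]
      simp only [mixedDiv_add])
    (fun t r p => by
      simp only [integral_const_mul, mixedDiv_smul, smul_eq_mul, mul_neg, Finset.mul_sum]
      congr 1
      refine Finset.sum_congr rfl fun i _ => Finset.sum_congr rfl fun c _ => ?_
      ring)
    (fun r p q => by
      simp only [integral_const_mul, Pi.add_apply, ← neg_add, ← Finset.sum_add_distrib]
      congr 1
      refine Finset.sum_congr rfl fun i _ => Finset.sum_congr rfl fun c _ => ?_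
      ring)
    (fun t r p => by
      simp only [integral_const_mul, Pi.smul_apply, smul_eq_mul, mul_neg, Finset.mul_sum, mul_assoc])

end Spaces

/-! ### Operators, preconditioner, condition number -/

section Operators

/-- The inverse of a bijective linear map (`0` for all other linear maps). -/
def inv {U U' : Type} [AddCommMonoid U] [Module ℝ U] [AddCommMonoid U'] [Module ℝ U']
    (T : U →ₗ[ℝ] U') : U' →ₗ[ℝ] U :=
  open Classical in
  if h : Function.Bijective T then (LinearEquiv.ofBijective T h).symm.toLinearMap else 0

/-- The operator norm of a linear map with respect to a norm `N`. -/
def opNorm {U : Type} [AddCommMonoid U] [Module ℝ U] (N : U → ℝ) (T : U →ₗ[ℝ] U) : ENNReal :=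
  ⨆ x : U, ENNReal.ofReal (N (T x)) / ENNReal.ofReal (N x)

/-- The condition number `κ(T) = ‖T‖ ‖T⁻¹‖` of a bijective linear map with respect to a
norm `N`. -/
def condNumber {U : Type} [AddCommMonoid U] [Module ℝ U] (N : U → ℝ) (T : U →ₗ[ℝ] U) : ENNReal :=
  opNorm N T * opNorm N (inv T)

variable {n : ℕ} {M : MixedDimMesh n} (P : Params M)

/-- `A : W_h → W_h'`. -/
def opA : W M →ₗ[ℝ] Module.Dual ℝ (W M) := aForm P

/-- `D_A : W_h → W_h'`. -/
def opDA : W M →ₗ[ℝ] Module.Dual ℝ (W M) := aDForm P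

variable (M) in
/-- `B : W_h → Q_h'`. -/
def opB : W M →ₗ[ℝ] Module.Dual ℝ (Q M) := bForm M

variable (M) in
/-- `Bᵀ : Q_h → W_h'`. -/
def opBT : Q M →ₗ[ℝ] Module.Dual ℝ (W M) := (bForm M).flip

/-- The discrete gradient `D_h : Q_h → W_h`, given by `a^D(D_h p, r) = b(r, p)` for all `r`. -/
def discGrad : Q M →ₗ[ℝ] W M := inv (opDA P) ∘ₗ opBT M

/-- `B D_A⁻¹ Bᵀ : Q_h → Q_h'`. -/
def opS : Q M →ₗ[ℝ] Module.Dual ℝ (Q M) := opB M ∘ₗ inv (opDA P) ∘ₗ opBT M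

/-- The operator `𝒜 = (A, Bᵀ; -B, 0) : X → X'` of the discrete system, where `X' = W_h' × Q_h'`. -/
def sysOp : X M →ₗ[ℝ] Module.Dual ℝ (W M) × Module.Dual ℝ (Q M) :=
  ((opA P).coprod (opBT M)).prod ((-opB M).coprod 0)

/-- The block diagonal preconditioner `ℬ_D = diag(A, B D_A⁻¹ Bᵀ)⁻¹ : X' → X`. -/
def precond : Module.Dual ℝ (W M) × Module.Dual ℝ (Q M) →ₗ[ℝ] X M :=
  inv ((opA P).prodMap (opS P))

/-- The weighted norm `|||(r, q)|||² = a(r, r) + a^D(D_h q, D_h q)`. -/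
def triNorm (x : X M) : ℝ :=
  Real.sqrt (aForm P x.1 x.1 + aDForm P (discGrad P x.2) (discGrad P x.2))

/-- `ℒ(w, p; r, q) = a(w, r) + a^D(D_h p, r) + a^D(D_h q, w)`. -/
def compForm (x y : X M) : ℝ :=
  aForm P x.1 y.1 + aDForm P (discGrad P x.2) y.1 + aDForm P (discGrad P y.2) x.1

/-- The continuity condition for `ℒ` with constant `α`. -/
def Continuity (α : ℝ) : Prop :=
  ∀ x y : X M, |compForm P x y| ≤ α * triNorm P x * triNorm P y

/-- The inf-sup condition for `ℒ` with constant `β`. -/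
def InfSup (β : ℝ) : Prop :=
  (β : EReal) ≤ ⨅ (y : X M) (_ : y ≠ 0), ⨆ (x : X M) (_ : x ≠ 0),
    ((compForm P x y / (triNorm P x * triNorm P y) : ℝ) : EReal)

end Operators

end

end MixedDim

/-!
A lowest-order Raviart–Thomas field on a cell is determined by its normal components on the facets.
On a shape-regular cell with constant permeability, its energy is comparable with the sum of the
energies of the single basis fields, so `a` and `a^D` are spectrally equivalent with constants that
depend only on the dimension, the shape regularity and the anisotropy of `K`.

The transpose of `B` is injective: a pressure in its kernel, tested with the fluxes given by its own
jumps across facets, has no jumps inside a subdomain and vanishes at the Dirichlet boundary; tested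
with the characteristic function of an interface, it takes the same value on both sides.

The rest is an abstract saddle point argument. Since `a^D(D_h p, r) = b(r, p)`, the form `ℒ` is `𝒜`
up to the sign of the pressure in its second argument, so `ℬ_D 𝒜` represents `ℒ` in the inner
product of `|||·|||` up to this reflection. Continuity of `ℒ` is the Cauchy–Schwarz inequality, and
the inf-sup condition for `(r, q)` follows with the test function `(r + C⁻¹ D_h q, -q)`, where
`a ≤ C a^D`.
-/

namespace MixedDim

/-! ### Measures of cones, convex sets and simplices -/

section Cone

variable {V P : Type*} [NormedAddCommGroup V] [InnerProductSpace ℝ V] [MetricSpace P]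
  [NormedAddTorsor V P]

/-- The cone with apex `p` over `S`: the union of the segments from `p` to the points of `S`. -/
def cone (p : P) (S : Set P) : Set P :=
  Set.image2 (fun a y => AffineMap.homothety p a y) (Set.Icc (0 : ℝ) 1) S

theorem isCompact_cone (p : P) {S : Set P} (hS : IsCompact S) : IsCompact (cone p S) := by
  rw [cone, ← Set.image_prod]
  refine (isCompact_Icc.prod hS).image ?_
  simp only [AffineMap.homothety_apply]
  fun_prop

theorem image_cone {V' P' : Type*} [NormedAddCommGroup V'] [InnerProductSpace ℝ V']
    [MetricSpace P'] [NormedAddTorsor V' P'] (f : P →ᵃ[ℝ] P') (p : P) (S : Set P) :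
    f '' cone p S = cone (f p) (f '' S) := by
  refine Set.image_image2_distrib_right fun a y => ?_
  simp only [AffineMap.homothety_eq_lineMap, AffineMap.apply_lineMap]

variable {p : P} {v : V} {S : Set P}

theorem mem_mk'_smul_vadd_orthogonal {x : ℝ} {z : P} :
    z ∈ AffineSubspace.mk' (x • v +ᵥ p) (ℝ ∙ v)ᗮ ↔ inner ℝ (z -ᵥ p) v = x * ‖v‖ ^ 2 := by
  rw [AffineSubspace.mem_mk', Submodule.mem_orthogonal_singleton_iff_inner_left,
    vsub_vadd_eq_vsub_sub, inner_sub_left, real_inner_smul_left, real_inner_self_eq_norm_sq,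
    sub_eq_zero]

theorem homothety_mem_mk'_smul_vadd_orthogonal (hv : v ≠ 0)
    (hS : ∀ y ∈ S, inner ℝ (y -ᵥ p) v = ‖v‖ ^ 2) {a x : ℝ} {y : P} (hy : y ∈ S) :
    AffineMap.homothety p a y ∈ AffineSubspace.mk' (x • v +ᵥ p) (ℝ ∙ v)ᗮ ↔ a = x := by
  have hv2 : ‖v‖ ^ 2 ≠ 0 := by simpa using hv
  rw [mem_mk'_smul_vadd_orthogonal, AffineMap.homothety_apply, vadd_vsub, real_inner_smul_left,
    hS y hy, mul_left_inj' hv2]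

theorem cone_inter_mk'_of_mem (hv : v ≠ 0) (hS : ∀ y ∈ S, inner ℝ (y -ᵥ p) v = ‖v‖ ^ 2) {x : ℝ}
    (hx : x ∈ Set.Icc (0 : ℝ) 1) :
    cone p S ∩ AffineSubspace.mk' (x • v +ᵥ p) (ℝ ∙ v)ᗮ = AffineMap.homothety p x '' S := by
  ext z
  constructor
  · rintro ⟨⟨a, _, y, hy, rfl⟩, h⟩
    exact ⟨y, hy, by rw [(homothety_mem_mk'_smul_vadd_orthogonal hv hS hy).1 h]⟩
  · rintro ⟨y, hy, rfl⟩
    exact ⟨⟨x, hx, y, hy, rfl⟩, (homothety_mem_mk'_smul_vadd_orthogonal hv hS hy).2 rfl⟩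

theorem cone_inter_mk'_of_notMem (hv : v ≠ 0) (hS : ∀ y ∈ S, inner ℝ (y -ᵥ p) v = ‖v‖ ^ 2) {x : ℝ}
    (hx : x ∉ Set.Icc (0 : ℝ) 1) :
    cone p S ∩ AffineSubspace.mk' (x • v +ᵥ p) (ℝ ∙ v)ᗮ = ∅ := by
  refine Set.eq_empty_of_forall_notMem ?_
  rintro _ ⟨⟨a, ha, y, hy, rfl⟩, h⟩
  exact hx ((homothety_mem_mk'_smul_vadd_orthogonal hv hS hy).1 h ▸ ha)

theorem lintegral_Ioc_enorm_pow (m : ℕ) :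
    ∫⁻ x in Set.Ioc (0 : ℝ) 1, ‖x‖ₑ ^ m = ((m : ENNReal) + 1)⁻¹ := by
  have h_eq : Set.EqOn (fun x : ℝ => ‖x‖ₑ ^ m) (fun x => ENNReal.ofReal (x ^ m)) (Set.Ioc 0 1) :=
    fun x hx => by simp only [ENNReal.ofReal_pow hx.1.le, Real.enorm_of_nonneg hx.1.le]
  rw [setLIntegral_congr_fun measurableSet_Ioc h_eq, ← ofReal_integral_eq_lintegral_ofReal,
    ← intervalIntegral.integral_of_le zero_le_one, integral_pow]
  · rw [one_pow, zero_pow m.succ_ne_zero, sub_zero, one_div,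
      ENNReal.ofReal_inv_of_pos (by positivity), ENNReal.ofReal_add (by positivity) zero_le_one,
      ENNReal.ofReal_natCast, ENNReal.ofReal_one]
  · exact ((continuous_pow m).integrableOn_Icc).mono_set Set.Ioc_subset_Icc_self
  · filter_upwards [ae_restrict_mem measurableSet_Ioc] with x hx
    exact pow_nonneg hx.1.le m

variable [MeasurableSpace P] [BorelSpace P]

theorem measure_cone_inter_mk' (d : ℕ) (hv : v ≠ 0)
    (hS : ∀ y ∈ S, inner ℝ (y -ᵥ p) v = ‖v‖ ^ 2) {x : ℝ} (hx : x ≠ 0) :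
    (μHE[d] : Measure P) (cone p S ∩ AffineSubspace.mk' (x • v +ᵥ p) (ℝ ∙ v)ᗮ) =
      (Set.Ioc (0 : ℝ) 1).indicator (fun x => ‖x‖ₑ ^ d * (μHE[d] : Measure P) S) x := by
  by_cases h : x ∈ Set.Ioc (0 : ℝ) 1
  · rw [cone_inter_mk'_of_mem hv hS (Set.Ioc_subset_Icc_self h),
      euclideanHausdorffMeasure_homothety_image d p hx, Set.indicator_of_mem h, ENNReal.smul_def,
      smul_eq_mul, ENNReal.coe_pow, enorm_eq_nnnorm]
  · have h' : x ∉ Set.Icc (0 : ℝ) 1 := fun h' => h ⟨h'.1.lt_of_ne hx.symm, h'.2⟩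
    rw [cone_inter_mk'_of_notMem hv hS h', measure_empty, Set.indicator_of_notMem h]

theorem measure_cone [FiniteDimensional ℝ V] (hv : v ≠ 0) (hSc : IsCompact S)
    (hS : ∀ y ∈ S, inner ℝ (y -ᵥ p) v = ‖v‖ ^ 2) :
    (Module.finrank ℝ V : ENNReal) * (μHE[Module.finrank ℝ V] : Measure P) (cone p S) =
      ‖v‖ₑ * (μHE[Module.finrank ℝ V - 1] : Measure P) S := by
  borelize V
  obtain ⟨m, hm⟩ : ∃ m, Module.finrank ℝ V = m + 1 :=
    Nat.exists_eq_succ_of_ne_zero (Module.finrank_pos_iff_exists_ne_zero.2 ⟨v, hv⟩).ne'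
  have slices : ∀ᵐ x : ℝ, (μHE[m] : Measure P)
      (cone p S ∩ AffineSubspace.mk' (x • v +ᵥ p) (ℝ ∙ v)ᗮ) =
      (Set.Ioc (0 : ℝ) 1).indicator (fun x => ‖x‖ₑ ^ m * (μHE[m] : Measure P) S) x := by
    filter_upwards [Measure.ae_ne volume (0 : ℝ)] with x hx
    exact measure_cone_inter_mk' m hv hS hx
  have cancel : ((m + 1 : ℕ) : ENNReal) * ((m : ENNReal) + 1)⁻¹ = 1 := by
    rw [Nat.cast_succ]
    exact ENNReal.mul_inv_cancel (by simp) (by simp)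
  rw [EuclideanGeometry.euclideanHausdorffMeasure_eq_lintegral p hv
    (isCompact_cone p hSc).measurableSet, hm, Nat.add_sub_cancel, lintegral_congr_ae slices,
    lintegral_indicator measurableSet_Ioc, lintegral_mul_const _ (by fun_prop),
    lintegral_Ioc_enorm_pow, mul_left_comm, ← mul_assoc ((m + 1 : ℕ) : ENNReal), cancel, one_mul]

end Cone

section Convex

variable {V : Type*} [NormedAddCommGroup V] [InnerProductSpace ℝ V] [FiniteDimensional ℝ V]
  [MeasurableSpace V] [BorelSpace V] {C C' : Set V}

theorem measure_coe_image_eq_volume (A : AffineSubspace ℝ V) [Nonempty A] (p : A) (S : Set A) :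
    (μHE[Module.finrank ℝ A.direction] : Measure V) ((↑) '' S) =
      volume (IsometryEquiv.vaddConst p ⁻¹' S) := by
  rw [AffineSubspace.euclideanHausdorffMeasure_coe_image,
    ← (EuclideanGeometry.measurePreserving_vaddConst p).measure_preimage_emb
      (IsometryEquiv.vaddConst p).toHomeomorph.measurableEmbedding]

theorem measure_intrinsicFrontier (hC : Convex ℝ C) :
    (μHE[Module.finrank ℝ (vectorSpan ℝ C)] : Measure V) (intrinsicFrontier ℝ C) = 0 := by
  rcases C.eq_empty_or_nonempty with rfl | ⟨p, hp⟩
  · simp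
  let p' : affineSpan ℝ C := ⟨p, subset_affineSpan ℝ C hp⟩
  have : Nonempty (affineSpan ℝ C) := ⟨p'⟩
  let e : (affineSpan ℝ C).direction ≃ₜ affineSpan ℝ C :=
    (IsometryEquiv.vaddConst p').toHomeomorph
  have hconv : Convex ℝ (e ⁻¹' ((↑) ⁻¹' C)) :=
    (hC.translate_preimage_left p).linear_preimage (affineSpan ℝ C).direction.subtype
  rw [intrinsicFrontier, ← direction_affineSpan, measure_coe_image_eq_volume _ p']
  exact (congrArg volume (e.preimage_frontier _)).trans (hconv.addHaar_frontier _)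

theorem measure_pos_of_convex (hC : Convex ℝ C) (hne : C.Nonempty) :
    0 < (μHE[Module.finrank ℝ (vectorSpan ℝ C)] : Measure V) C := by
  obtain ⟨p, hp⟩ := hne
  let p' : affineSpan ℝ C := ⟨p, subset_affineSpan ℝ C hp⟩
  have : Nonempty (affineSpan ℝ C) := ⟨p'⟩
  let e : (affineSpan ℝ C).direction ≃ᵢ affineSpan ℝ C := IsometryEquiv.vaddConst p'
  have hint : (interior ((↑) ⁻¹' C : Set (affineSpan ℝ C))).Nonempty :=
    Set.image_nonempty.1 (Set.Nonempty.intrinsicInterior hC ⟨p, hp⟩)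
  refine lt_of_lt_of_le ?_ (measure_mono (intrinsicInterior_subset (𝕜 := ℝ)))
  rw [intrinsicInterior, ← direction_affineSpan, measure_coe_image_eq_volume _ p']
  exact (isOpen_interior.preimage e.continuous).measure_pos _ (hint.preimage e.surjective)

theorem measure_inter_eq_zero {d : ℕ} (hC : Convex ℝ C) (hC' : Convex ℝ C')
    (hd : Module.finrank ℝ (vectorSpan ℝ C) = d) (hd' : Module.finrank ℝ (vectorSpan ℝ C') = d)
    (h : Disjoint (intrinsicInterior ℝ C) (intrinsicInterior ℝ C')) :
    (μHE[d] : Measure V) (C ∩ C') = 0 := by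
  have hsub : C ∩ C' ⊆ intrinsicFrontier ℝ C ∪ intrinsicFrontier ℝ C' := by
    rintro x ⟨hx, hx'⟩
    have hxC := subset_intrinsicClosure (𝕜 := ℝ) hx
    have hxC' := subset_intrinsicClosure (𝕜 := ℝ) hx'
    rw [← intrinsicInterior_union_intrinsicFrontier] at hxC hxC'
    exact hxC.elim (fun hx => Or.inr (hxC'.resolve_left (Set.disjoint_left.1 h hx))) Or.inl
  exact measure_mono_null hsub (measure_union_null (hd ▸ measure_intrinsicFrontier hC)
    (hd' ▸ measure_intrinsicFrontier hC'))

theorem vectorSpan_convexHull {U : Type*} [AddCommGroup U] [Module ℝ U] (S : Set U) :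
    vectorSpan ℝ (convexHull ℝ S) = vectorSpan ℝ S := by
  rw [← direction_affineSpan, ← direction_affineSpan, affineSpan_convexHull]

end Convex

section Simplex

variable {n d : ℕ} (s : Affine.Simplex ℝ (E n) d)

theorem convex_body : Convex ℝ (body s) := convex_convexHull _ _

theorem finrank_vectorSpan_body : Module.finrank ℝ (vectorSpan ℝ (body s)) = d := by
  rw [body, vectorSpan_convexHull]
  exact s.independent.finrank_vectorSpan (by simp)

theorem points_mem_body (k : Fin (d + 1)) : s.points k ∈ body s :=
  subset_convexHull ℝ _ (Set.mem_range_self k)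

theorem points_mem_facet {j k : Fin (d + 1)} (h : j ≠ k) : s.points j ∈ facet s k :=
  subset_convexHull ℝ _ (Set.mem_image_of_mem _ h)

theorem measure_body_pos : 0 < (μHE[d] : Measure (E n)) (body s) := by
  simpa only [finrank_vectorSpan_body] using
    measure_pos_of_convex (convex_body s) ⟨_, points_mem_body s 0⟩

theorem measureReal_body_pos : 0 < (μHE[d] : Measure (E n)).real (body s) :=
  ENNReal.toReal_pos (measure_body_pos s).ne' (measure_body_lt_top s).ne

theorem measure_body_inter_eq_zero (t : Affine.Simplex ℝ (E n) d)
    (h : Disjoint (intrinsicInterior ℝ (body s)) (intrinsicInterior ℝ (body t))) :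
    (μHE[d] : Measure (E n)) (body s ∩ body t) = 0 :=
  measure_inter_eq_zero (convex_body s) (convex_body t) (finrank_vectorSpan_body s)
    (finrank_vectorSpan_body t) h

theorem isCompact_facet (k : Fin (d + 1)) : IsCompact (facet s k) :=
  ((Set.toFinite _).image _).isCompact_convexHull ℝ

theorem convex_facet (k : Fin (d + 1)) : Convex ℝ (facet s k) := convex_convexHull _ _

variable [NeZero d] (k : Fin (d + 1))

theorem facet_eq_body : facet s k = body (s.faceOpposite k) := by
  rw [facet, body, Affine.Simplex.range_faceOpposite_points]

theorem facet_nonempty : (facet s k).Nonempty := by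
  rw [facet_eq_body]
  exact ⟨_, points_mem_body _ 0⟩

theorem finrank_vectorSpan_facet : Module.finrank ℝ (vectorSpan ℝ (facet s k)) = d - 1 := by
  rw [facet_eq_body, finrank_vectorSpan_body]

theorem measure_facet_pos : 0 < (μHE[d - 1] : Measure (E n)) (facet s k) := by
  rw [facet_eq_body]
  exact measure_body_pos _

theorem measure_facet_lt_top : (μHE[d - 1] : Measure (E n)) (facet s k) < ⊤ := by
  rw [facet_eq_body]
  exact measure_body_lt_top _

theorem facetHeight_eq_height : facetHeight s k = s.height k := by
  rw [facetHeight, dif_neg (NeZero.ne d)]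

theorem facetHeight_pos : 0 < facetHeight s k := by
  rw [facetHeight_eq_height]
  exact s.height_pos k

theorem norm_outwardNormal : ‖outwardNormal s k‖ = 1 := by
  have hnorm : ‖s.altitudeFoot k - s.points k‖ = s.height k := by
    rw [← dist_eq_norm, dist_comm, Affine.Simplex.height]
  rw [outwardNormal, dif_neg (NeZero.ne d), norm_smul, hnorm, norm_inv,
    Real.norm_of_nonneg (s.height_pos k).le, inv_mul_cancel₀ (s.height_pos k).ne']

theorem outwardNormal_mem_direction :
    outwardNormal s k ∈ (affineSpan ℝ (Set.range s.points)).direction := by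
  rw [outwardNormal, dif_neg (NeZero.ne d)]
  exact Submodule.smul_mem _ _ (AffineSubspace.vsub_mem_direction
    (Affine.Simplex.altitudeFoot_mem_affineSpan _ _) (mem_affineSpan ℝ (Set.mem_range_self _)))

theorem body_eq_cone : body s = cone (s.points k) (facet s k) := by
  have hrange : Set.range s.points = insert (s.points k) (s.points '' {k}ᶜ) := by
    rw [← Set.image_insert_eq, ← Set.image_univ, Set.insert_eq, Set.union_compl_self]
  have hne : (s.points '' {k}ᶜ).Nonempty := convexHull_nonempty_iff.1 (facet_nonempty s k)
  ext x
  rw [body, hrange, convexHull_insert hne, convexJoin_singleton_left]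
  simp only [cone, facet, Set.mem_iUnion₂, segment_eq_image_lineMap, Set.mem_image,
    Set.mem_image2, AffineMap.homothety_eq_lineMap]
  constructor
  · rintro ⟨y, hy, a, ha, rfl⟩
    exact ⟨a, ha, y, hy, rfl⟩
  · rintro ⟨a, ha, y, hy, rfl⟩
    exact ⟨y, hy, a, ha, rfl⟩

theorem mul_measure_body_eq :
    (d : ENNReal) * (μHE[d] : Measure (E n)) (body s) =
      ENNReal.ofReal (facetHeight s k) * (μHE[d - 1] : Measure (E n)) (facet s k) := by
  set A := affineSpan ℝ (Set.range s.points) with hA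
  let p : A := ⟨s.points k, mem_affineSpan ℝ (Set.mem_range_self k)⟩
  have : Nonempty A := ⟨p⟩
  have hfinrank : Module.finrank ℝ A.direction = d := by
    rw [hA, direction_affineSpan]
    exact s.independent.finrank_vectorSpan (by simp)
  let f : Set A := (↑) ⁻¹' facet s k
  have hf : (↑) '' f = facet s k :=
    Subtype.image_preimage_coe _ _ |>.trans (Set.inter_eq_right.2
      ((facet_subset_body s k).trans (convexHull_subset_affineSpan _)))
  have hbody : (↑) '' cone p f = body s := by
    rw [body_eq_cone s k, ← hf]
    exact image_cone A.subtype p f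
  have hfc : IsCompact f := Topology.IsClosedEmbedding.isCompact_preimage
    A.closed_of_finiteDimensional.isClosedEmbedding_subtypeVal (isCompact_facet s k)
  have hh := facetHeight_pos s k
  let v : A.direction := facetHeight s k • ⟨outwardNormal s k, outwardNormal_mem_direction s k⟩
  have hv : ‖v‖ = facetHeight s k := by
    rw [norm_smul, Submodule.coe_norm, norm_outwardNormal, mul_one, Real.norm_of_nonneg hh.le]
  have hfv : ∀ y ∈ f, inner ℝ (y -ᵥ p) v = ‖v‖ ^ 2 := fun y hy => by
    rw [hv, Submodule.coe_inner, Submodule.coe_smul, real_inner_smul_right, sq]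
    exact congrArg _ ((inner_sub_outwardNormal s k k hy).trans (if_pos rfl))
  have hv0 : v ≠ 0 := norm_ne_zero_iff.1 (hv ▸ hh.ne')
  have hcone := measure_cone (V := A.direction) (P := A) hv0 hfc hfv
  rwa [← AffineSubspace.euclideanHausdorffMeasure_coe_image, hbody,
    ← AffineSubspace.euclideanHausdorffMeasure_coe_image, hf, hfinrank, ← ofReal_norm, hv] at hcone

theorem mul_measureReal_body_eq :
    (d : ℝ) * (μHE[d] : Measure (E n)).real (body s) =
      facetHeight s k * (μHE[d - 1] : Measure (E n)).real (facet s k) := by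
  have h := congrArg ENNReal.toReal (mul_measure_body_eq s k)
  rwa [ENNReal.toReal_mul, ENNReal.toReal_mul, ENNReal.toReal_natCast,
    ENNReal.toReal_ofReal (facetHeight_pos s k).le] at h

theorem measureReal_facet_eq :
    (μHE[d - 1] : Measure (E n)).real (facet s k) =
      (facetHeight s k)⁻¹ * d * (μHE[d] : Measure (E n)).real (body s) := by
  rw [mul_assoc, mul_measureReal_body_eq s k, inv_mul_cancel_left₀ (facetHeight_pos s k).ne']

theorem inner_sub_outwardNormal_mem_Icc {x : E n} (hx : x ∈ body s) :
    inner ℝ (x - s.points k) (outwardNormal s k) ∈ Set.Icc 0 (facetHeight s k) := by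
  rw [body_eq_cone s k] at hx
  obtain ⟨a, ha, y, hy, rfl⟩ := hx
  have hh := facetHeight_pos s k
  have hinner : inner ℝ (AffineMap.homothety (s.points k) a y - s.points k) (outwardNormal s k) =
      a * facetHeight s k := by
    rw [AffineMap.homothety_apply, vadd_eq_add, add_sub_cancel_right, real_inner_smul_left,
      vsub_eq_sub, inner_sub_outwardNormal s k k hy, if_pos rfl]
  rw [hinner]
  exact ⟨mul_nonneg ha.1 hh.le, mul_le_of_le_one_left hh.le ha.2⟩

theorem two_mul_le_facetHeight {z : E n} (hz : z ∈ affineSpan ℝ (Set.range s.points)) {r : ℝ}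
    (hr : 0 ≤ r)
    (h : Metric.closedBall z r ∩ (affineSpan ℝ (Set.range s.points) : Set (E n)) ⊆ body s) :
    2 * r ≤ facetHeight s k := by
  have hν := norm_outwardNormal s k
  have hmem : ∀ t : ℝ, |t| ≤ r → z + t • outwardNormal s k ∈ body s := by
    intro t ht
    refine h ⟨by simpa [norm_smul, hν] using ht, ?_⟩
    rw [add_comm z]
    exact AffineSubspace.vadd_mem_of_mem_direction
      (Submodule.smul_mem _ _ (outwardNormal_mem_direction s k)) hz
  have hinner : ∀ t : ℝ, inner ℝ (z + t • outwardNormal s k - s.points k) (outwardNormal s k) =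
      inner ℝ (z - s.points k) (outwardNormal s k) + t := by
    intro t
    rw [add_sub_right_comm, inner_add_left, real_inner_smul_left, real_inner_self_eq_norm_sq, hν,
      one_pow, mul_one]
  have h_top := (inner_sub_outwardNormal_mem_Icc s k (hmem r (abs_of_nonneg hr).le)).2
  have h_bot := (inner_sub_outwardNormal_mem_Icc s k
    (hmem (-r) (by rw [abs_neg, abs_of_nonneg hr]))).1
  rw [hinner] at h_top h_bot
  linarith

end Simplex

/-! ### Mean squares of affine maps -/

theorem integrableOn_of_isCompact {X F : Type*} [TopologicalSpace X] [MeasurableSpace X]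
    [OpensMeasurableSpace X] [T2Space X] [NormedAddCommGroup F] [SecondCountableTopologyEither X F]
    {f : X → F} (hf : Continuous f) {C : Set X}
    (hC : IsCompact C) {μ : Measure X} (hμ : μ C < ⊤) : IntegrableOn f C μ := by
  obtain ⟨B, hB⟩ := hC.exists_bound_of_continuousOn hf.continuousOn
  exact IntegrableOn.of_bound hμ hf.aestronglyMeasurable B
    ((ae_restrict_iff' hC.measurableSet).2 (.of_forall hB))

section AffineMap

variable {V F : Type*} [NormedAddCommGroup V] [InnerProductSpace ℝ V] [NormedAddCommGroup F]
  [NormedSpace ℝ F]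

theorem norm_sq_apply_le (g : V →ᵃ[ℝ] F) (x y : V) :
    ‖g y‖ ^ 2 ≤ 8 * ‖g (AffineMap.homothety y (2⁻¹ : ℝ) x)‖ ^ 2 + 2 * ‖g x‖ ^ 2 := by
  have hg : g y = (2 : ℝ) • g (AffineMap.homothety y (2⁻¹ : ℝ) x) - g x := by
    rw [AffineMap.homothety_eq_lineMap, AffineMap.apply_lineMap, AffineMap.lineMap_apply_module]
    module
  have h := norm_sub_le ((2 : ℝ) • g (AffineMap.homothety y (2⁻¹ : ℝ) x)) (g x)
  rw [← hg, norm_smul, Real.norm_ofNat] at h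
  nlinarith [norm_nonneg (g y),
    sq_nonneg (2 * ‖g (AffineMap.homothety y (2⁻¹ : ℝ) x)‖ - ‖g x‖)]

variable [MeasurableSpace V] [BorelSpace V]

theorem setIntegral_comp_homothety (d : ℕ) (p : V) {c : ℝ} (hc : c ≠ 0) (S : Set V) (g : V → F) :
    ∫ x in S, g (AffineMap.homothety p c x) ∂μHE[d] =
      (‖c‖⁻¹ ^ d) • ∫ x in AffineMap.homothety p c '' S, g x ∂μHE[d] := by
  have hcont : Continuous (AffineMap.homothety p c : V → V) := AffineMap.homothety_continuous p c
  have hinj : Function.Injective (AffineMap.homothety p c : V → V) := fun x y h => by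
    simpa [AffineMap.homothety_apply, hc] using h
  have hemb : MeasurableEmbedding (AffineMap.homothety p c : V → V) :=
    (Topology.IsOpenEmbedding.of_continuous_injective_isOpenMap hcont hinj
      (AffineMap.homothety_isOpenMap p c hc)).measurableEmbedding
  have hmap : Measure.map (AffineMap.homothety p c) (μHE[d] : Measure V) =
      (‖c‖₊⁻¹ ^ d) • (μHE[d] : Measure V) := by
    ext A hA
    rw [Measure.map_apply hcont.measurable hA, euclideanHausdorffMeasure_homothety_preimage d p hc,
      Measure.smul_apply]
  have h := hemb.setIntegral_map (μ := (μHE[d] : Measure V)) g (AffineMap.homothety p c '' S)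
  rw [hinj.preimage_image, hmap, Measure.restrict_smul, integral_smul_nnreal_measure] at h
  rw [← h, NNReal.smul_def, NNReal.coe_pow, NNReal.coe_inv, coe_nnnorm]

-- Shrinking `C` by `1/2` towards `y` keeps it inside `C` and divides the measure by `2 ^ d`.
theorem norm_sq_mul_measureReal_le [FiniteDimensional ℝ V] (g : V →ᵃ[ℝ] F) {d : ℕ} {C : Set V}
    (hC : IsCompact C) (hconv : Convex ℝ C) (hμ : (μHE[d] : Measure V) C < ⊤) {y : V}
    (hy : y ∈ C) :
    ‖g y‖ ^ 2 * (μHE[d] : Measure V).real C ≤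
      (2 ^ (d + 3) + 2) * ∫ x in C, ‖g x‖ ^ 2 ∂μHE[d] := by
  set h : V →ᵃ[ℝ] V := AffineMap.homothety y (2⁻¹ : ℝ)
  have hg : Continuous g := g.continuous_of_finiteDimensional
  have hh : Continuous h := h.continuous_of_finiteDimensional
  have hint : IntegrableOn (fun x => ‖g x‖ ^ 2) C μHE[d] :=
    integrableOn_of_isCompact (by fun_prop) hC hμ
  have hint' : IntegrableOn (fun x => ‖g (h x)‖ ^ 2) C μHE[d] :=
    integrableOn_of_isCompact (by fun_prop) hC hμ
  have hsub : h '' C ⊆ C := by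
    rintro _ ⟨x, hx, rfl⟩
    rw [AffineMap.homothety_eq_lineMap]
    exact hconv.lineMap_mem hy hx ⟨by norm_num, by norm_num⟩
  have hshrink : ∫ x in C, ‖g (h x)‖ ^ 2 ∂μHE[d] ≤ 2 ^ d * ∫ x in C, ‖g x‖ ^ 2 ∂μHE[d] := by
    rw [setIntegral_comp_homothety d y (by norm_num) C fun x => ‖g x‖ ^ 2, norm_inv, inv_inv,
      Real.norm_ofNat, smul_eq_mul]
    gcongr
    exact .of_forall fun x => sq_nonneg _
  calc ‖g y‖ ^ 2 * (μHE[d] : Measure V).real C = ∫ _ in C, ‖g y‖ ^ 2 ∂μHE[d] := by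
        rw [setIntegral_const, smul_eq_mul, mul_comm]
    _ ≤ ∫ x in C, (8 * ‖g (h x)‖ ^ 2 + 2 * ‖g x‖ ^ 2) ∂μHE[d] :=
        integral_mono (integrableOn_const hμ.ne) ((hint'.const_mul 8).add (hint.const_mul 2))
          fun x => norm_sq_apply_le g x y
    _ = 8 * ∫ x in C, ‖g (h x)‖ ^ 2 ∂μHE[d] + 2 * ∫ x in C, ‖g x‖ ^ 2 ∂μHE[d] := by
        rw [integral_add (hint'.const_mul 8) (hint.const_mul 2), integral_const_mul,
          integral_const_mul]
    _ ≤ 8 * (2 ^ d * ∫ x in C, ‖g x‖ ^ 2 ∂μHE[d]) + 2 * ∫ x in C, ‖g x‖ ^ 2 ∂μHE[d] := by gcongr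
    _ = (2 ^ (d + 3) + 2) * ∫ x in C, ‖g x‖ ^ 2 ∂μHE[d] := by ring

end AffineMap

/-! ### Quadratic forms and positive operators -/

section Quadratic

theorem apply_sum_sum_le {U ι : Type*} [AddCommGroup U] [Module ℝ U] [Fintype ι]
    (B : U →ₗ[ℝ] U →ₗ[ℝ] ℝ) (hB : ∀ x, 0 ≤ B x x) (w : ι → U) :
    B (∑ k, w k) (∑ k, w k) ≤ Fintype.card ι * ∑ k, B (w k) (w k) := by
  have hnonneg : 0 ≤ ∑ k, ∑ j, B (w k - w j) (w k - w j) :=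
    Finset.sum_nonneg fun k _ => Finset.sum_nonneg fun j _ => hB _
  have hexpand : ∑ k, ∑ j, B (w k - w j) (w k - w j) =
      2 * (Fintype.card ι * ∑ k, B (w k) (w k)) - 2 * B (∑ k, w k) (∑ k, w k) := by
    have hcomm : ∑ k, ∑ j, B (w j) (w k) = ∑ k, ∑ j, B (w k) (w j) := Finset.sum_comm
    simp only [map_sub, LinearMap.sub_apply, map_sum, LinearMap.sum_apply, Finset.sum_sub_distrib,
      Finset.sum_const, Finset.card_univ, nsmul_eq_mul, ← Finset.mul_sum, hcomm]
    ring
  linarith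

variable {F : Type*} [NormedAddCommGroup F] [InnerProductSpace ℝ F] {T : F ≃ₗ[ℝ] F}

theorem inner_symm_apply_self_le {κ : ℝ} (hκ : 0 < κ)
    (h : ∀ v, κ * ‖v‖ ^ 2 ≤ inner ℝ (T v) v) (u : F) :
    inner ℝ (T.symm u) u ≤ κ⁻¹ * ‖u‖ ^ 2 := by
  have hlower := h (T.symm u)
  rw [T.apply_symm_apply, real_inner_comm] at hlower
  have hupper := real_inner_le_norm (T.symm u) u
  rw [inv_mul_eq_div, le_div_iff₀ hκ]
  nlinarith [sq_nonneg (κ * ‖T.symm u‖ - ‖u‖)]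

theorem norm_sq_le_mul_inner_symm_apply_self (hT : (T : F →ₗ[ℝ] F).IsPositive) {t : ℝ}
    (h : ∀ v, inner ℝ (T v) v ≤ t * ‖v‖ ^ 2) (u : F) :
    ‖u‖ ^ 2 ≤ t * inner ℝ (T.symm u) u := by
  rcases eq_or_ne u 0 with rfl | hu
  · simp
  have hcs := LinearMap.BilinForm.apply_sq_le_of_symm (innerₗ F ∘ₗ (T : F →ₗ[ℝ] F))
    hT.inner_nonneg_left ⟨fun x y => (hT.isSymmetric x y).trans (real_inner_comm _ _)⟩ (T.symm u) u
  simp only [LinearMap.comp_apply, innerₗ_apply_apply, LinearEquiv.coe_coe, T.apply_symm_apply,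
    real_inner_self_eq_norm_sq] at hcs
  rw [real_inner_comm] at hcs
  have hnonneg : 0 ≤ inner ℝ (T.symm u) u := hT.toLinearMap_symm.inner_nonneg_left u
  have hpos : 0 < ‖u‖ ^ 2 := by positivity
  refine le_of_mul_le_mul_right ?_ hpos
  calc ‖u‖ ^ 2 * ‖u‖ ^ 2 ≤ inner ℝ (T.symm u) u * inner ℝ (T u) u := by rwa [← sq]
    _ ≤ inner ℝ (T.symm u) u * (t * ‖u‖ ^ 2) := mul_le_mul_of_nonneg_left (h u) hnonneg
    _ = t * inner ℝ (T.symm u) u * ‖u‖ ^ 2 := by ring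

end Quadratic

/-! ### Raviart–Thomas fields on one cell -/

section RaviartThomas

variable {n : ℕ} {D : Submodule ℝ (E n)} {p : E n}

theorem exists_affineMap_of_mem_rtPoly {v : E n → D} (hv : v ∈ rtPoly D p) :
    ∃ g : E n →ᵃ[ℝ] D, ⇑g = v := by
  obtain ⟨a, b, h⟩ := hv
  refine ⟨AffineMap.const ℝ (E n) (a - b • D.orthogonalProjectionOnto p) +
    (b • (D.orthogonalProjectionOnto : E n →ₗ[ℝ] D)).toAffineMap, funext fun x => ?_⟩
  rw [h, map_sub]
  simp only [AffineMap.coe_add, AffineMap.coe_const, LinearMap.coe_toAffineMap, Pi.add_apply,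
    Function.const_apply, LinearMap.smul_apply, ContinuousLinearMap.coe_coe]
  module

theorem rtPoly_eq_range (D : Submodule ℝ (E n)) (p : E n) :
    rtPoly D p = LinearMap.range (LinearMap.coprod (LinearMap.pi fun _ : E n => LinearMap.id)
      (LinearMap.toSpanSingleton ℝ (E n → D) fun x => D.orthogonalProjectionOnto (x - p))) := by
  ext v
  constructor
  · rintro ⟨a, b, h⟩
    exact ⟨(a, b), funext fun x => (h x).symm⟩
  · rintro ⟨⟨a, b⟩, rfl⟩
    exact ⟨a, b, fun x => rfl⟩

instance finite_rtPoly (D : Submodule ℝ (E n)) (p : E n) : Module.Finite ℝ (rtPoly D p) := by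
  rw [rtPoly_eq_range]
  infer_instance

theorem finrank_rtPoly_le (D : Submodule ℝ (E n)) (p : E n) :
    Module.finrank ℝ (rtPoly D p) ≤ Module.finrank ℝ D + 1 := by
  rw [rtPoly_eq_range]
  refine (LinearMap.finrank_range_le _).trans_eq ?_
  rw [Module.finrank_prod, Module.finrank_self]

variable {d : ℕ} (s : Affine.Simplex ℝ (E n) d)

theorem continuous_rtBasis (k : Fin (d + 1)) : Continuous (rtBasis D s k) :=
  (rtPoly_contDiff (rtBasis_mem D s k)).continuous

theorem norm_rtBasis_le [NeZero d] (k : Fin (d + 1)) {x : E n} (hx : x ∈ body s) :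
    ‖rtBasis D s k x‖ ≤ (facetHeight s k)⁻¹ * Metric.diam (body s) := by
  have hh := facetHeight_pos s k
  rw [rtBasis, norm_smul, norm_inv, Real.norm_of_nonneg hh.le]
  refine mul_le_mul_of_nonneg_left ?_ (inv_nonneg.2 hh.le)
  calc ‖D.orthogonalProjectionOnto (x - s.points k)‖ ≤ ‖x - s.points k‖ :=
        Submodule.norm_orthogonalProjectionOnto_apply_le D _
    _ = dist x (s.points k) := (dist_eq_norm _ _).symm
    _ ≤ Metric.diam (body s) :=
        Metric.dist_le_diam_of_mem (isCompact_body s).isBounded hx (points_mem_body s k)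

theorem facetBarycenter_mem_facet [NeZero d] (k : Fin (d + 1)) :
    facetBarycenter s k ∈ facet s k := by
  have hd : (d : ℝ) ≠ 0 := NeZero.ne _
  rw [facetBarycenter, Finset.smul_sum]
  refine (convex_facet s k).sum_mem (fun _ _ => by positivity) ?_ fun j hj =>
    points_mem_facet s (Finset.ne_of_mem_erase hj)
  rw [Finset.sum_const, Finset.card_erase_of_mem (Finset.mem_univ k), Finset.card_univ,
    Fintype.card_fin, Nat.add_sub_cancel, nsmul_eq_mul, mul_inv_cancel₀ hd]

end RaviartThomas

section Cell

variable {n : ℕ} {M : MixedDimMesh n} {i : M.Sub}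

theorem finrank_dir (i : M.Sub) : Module.finrank ℝ (M.dir i) = M.dim i := by
  obtain ⟨c⟩ := M.cellNonempty i
  rw [MixedDimMesh.dir, ← M.affineSpan_simplex i c, direction_affineSpan]
  exact (M.simplex i c).independent.finrank_vectorSpan (by simp)

theorem subsingleton_dir (h : M.dim i = 0) : Subsingleton (M.dir i) :=
  Module.finrank_zero_iff.1 (by rw [finrank_dir, h])

variable (c : M.Cell i)

theorem inner_sum_smul_rtBasis (g : Fin (M.dim i + 1) → ℝ) (k : Fin (M.dim i + 1)) {x : E n}
    (hx : x ∈ facet (M.simplex i c) k) :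
    inner ℝ ((∑ j, g j • rtBasis (M.dir i) (M.simplex i c) j) x : E n)
      (outwardNormal (M.simplex i c) k) = g k := by
  simp only [Finset.sum_apply, Pi.smul_apply, Submodule.coe_sum, Submodule.coe_smul, sum_inner,
    real_inner_smul_left, inner_rtBasis i c k _ hx, mul_ite, mul_one, mul_zero, Finset.sum_ite_eq',
    Finset.mem_univ, if_true]

theorem linearIndependent_rtBasis [NeZero (M.dim i)] :
    LinearIndependent ℝ (rtBasis (M.dir i) (M.simplex i c)) := by
  refine Fintype.linearIndependent_iff.2 fun g hg k => ?_
  rw [← inner_sum_smul_rtBasis c g k (facetBarycenter_mem_facet _ k), hg, Pi.zero_apply,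
    Submodule.coe_zero, inner_zero_left]

theorem span_range_rtBasis [NeZero (M.dim i)] :
    Submodule.span ℝ (Set.range (rtBasis (M.dir i) (M.simplex i c))) =
      rtPoly (M.dir i) ((M.simplex i c).points 0) := by
  refine Submodule.eq_of_le_of_finrank_le
    (Submodule.span_le.2 (Set.range_subset_iff.2 (rtBasis_mem _ _))) ?_
  rw [finrank_span_eq_card (linearIndependent_rtBasis c), Fintype.card_fin]
  exact (finrank_rtPoly_le _ _).trans_eq (congrArg (· + 1) (finrank_dir i))

variable {c} {v : E n → M.dir i}

theorem eq_sum_inner_smul_rtBasis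
    (hv : v ∈ rtPoly (M.dir i) ((M.simplex i c).points 0)) :
    v = ∑ k, (inner ℝ (v (facetBarycenter (M.simplex i c) k) : E n)
      (outwardNormal (M.simplex i c) k) : ℝ) • rtBasis (M.dir i) (M.simplex i c) k := by
  by_cases h0 : M.dim i = 0
  · have := subsingleton_dir h0
    exact Subsingleton.elim _ _
  have : NeZero (M.dim i) := ⟨h0⟩
  rw [← span_range_rtBasis, Submodule.mem_span_range_iff_exists_fun] at hv
  obtain ⟨g, rfl⟩ := hv
  simp only [inner_sum_smul_rtBasis c g _ (facetBarycenter_mem_facet _ _)]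

theorem inner_outwardNormal_sq_mul_measureReal_le [NeZero (M.dim i)]
    (hv : v ∈ rtPoly (M.dir i) ((M.simplex i c).points 0)) (k : Fin (M.dim i + 1)) :
    (inner ℝ (v (facetBarycenter (M.simplex i c) k) : E n) (outwardNormal (M.simplex i c) k)) ^ 2
      * (μHE[M.dim i] : Measure (E n)).real (body (M.simplex i c)) ≤
      (2 ^ (M.dim i + 3) + 2) * ∫ x in body (M.simplex i c), ‖v x‖ ^ 2 ∂μHE[M.dim i] := by
  let s := M.simplex i c
  obtain ⟨g, rfl⟩ := exists_affineMap_of_mem_rtPoly hv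
  have hinner : |inner ℝ (g (facetBarycenter s k) : E n) (outwardNormal s k)| ≤
      ‖g (facetBarycenter s k)‖ := by
    simpa only [norm_outwardNormal, mul_one, Submodule.coe_norm] using
      abs_real_inner_le_norm (g (facetBarycenter s k) : E n) (outwardNormal s k)
  refine le_trans ?_ (norm_sq_mul_measureReal_le g (isCompact_body s) (convex_body s)
    (measure_body_lt_top s) (facet_subset_body s k (facetBarycenter_mem_facet s k)))
  exact mul_le_mul_of_nonneg_right (sq_le_sq' (abs_le.1 hinner).1 (abs_le.1 hinner).2)
    measureReal_nonneg

end Cell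

section Permeability

variable {n : ℕ} {M : MixedDimMesh n} (P : Params M) (i : M.Sub)

theorem isPositive_K : (P.K i : M.dir i →ₗ[ℝ] M.dir i).IsPositive := by
  refine ⟨P.K_symm i, fun v => ?_⟩
  rcases eq_or_ne v 0 with rfl | hv
  · simp
  · exact (P.K_pos i v hv).le

theorem inner_K_symm_nonneg (u : M.dir i) : 0 ≤ inner ℝ ((P.K i).symm u) u :=
  (isPositive_K P i).toLinearMap_symm.inner_nonneg_left u

end Permeability

/-! ### Fluxes through facets -/

noncomputable section

variable {n : ℕ} {M : MixedDimMesh n}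

/-- The normal component of an `RT₀` field on a facet, where it is constant; as in `diagMassForm`,
it is read off at the barycentre. -/
def flux (v : Field M) (i : M.Sub) (c : M.Cell i) (k : Fin (M.dim i + 1)) : ℝ :=
  normalTrace v i c k (facetBarycenter (M.simplex i c) k)

/-- The elementwise `RT₀` field with prescribed fluxes. -/
def ofFlux (g : ∀ i, M.Cell i → Fin (M.dim i + 1) → ℝ) : Field M :=
  fun i c => ∑ k, g i c k • rtBasis (M.dir i) (M.simplex i c) k

theorem normalTrace_ofFlux (g : ∀ i, M.Cell i → Fin (M.dim i + 1) → ℝ) (i : M.Sub) (c : M.Cell i)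
    (k : Fin (M.dim i + 1)) {x : E n} (hx : x ∈ facet (M.simplex i c) k) :
    normalTrace (ofFlux g) i c k x = g i c k :=
  inner_sum_smul_rtBasis c (g i c) k hx

theorem ofFlux_mem {g : ∀ i, M.Cell i → Fin (M.dim i + 1) → ℝ}
    (hinterior : ∀ i c k c' k', M.kind i c k = .interior c' k' → g i c k + g i c' k' = 0)
    (hneumann : ∀ i c k, M.kind i c k = .neumann → g i c k = 0) : ofFlux g ∈ V M := by
  refine ⟨fun i c => Submodule.sum_mem _ fun k _ => Submodule.smul_mem _ _ (rtBasis_mem _ _ _),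
    fun i c k c' k' hk x hx => ?_, fun i c k hk x hx => ?_⟩
  · have hx' : x ∈ facet (M.simplex i c') k' := (M.interior_shared i c k c' k' hk).2 ▸ hx
    rw [normalTrace_ofFlux g i c k hx, normalTrace_ofFlux g i c' k' hx', hinterior i c k c' k' hk]
  · rw [normalTrace_ofFlux g i c k hx, hneumann i c k hk]

theorem eq_sum_flux (v : V M) (i : M.Sub) (c : M.Cell i) :
    v.1 i c = ∑ k, flux v.1 i c k • rtBasis (M.dir i) (M.simplex i c) k :=
  eq_sum_inner_smul_rtBasis (v.2.1 i c)

theorem eq_zero_of_flux {v : V M} (h : ∀ i c k, flux v.1 i c k = 0) : v = 0 := by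
  refine Subtype.ext (funext fun i => funext fun c => ?_)
  rw [eq_sum_flux v i c]
  exact Finset.sum_eq_zero fun k _ => by rw [h, zero_smul]

theorem flux_eq_zero_of_dim_eq_zero (v : Field M) {i : M.Sub} (h : M.dim i = 0) (c : M.Cell i)
    (k : Fin (M.dim i + 1)) : flux v i c k = 0 := by
  have := subsingleton_dir h
  rw [flux, normalTrace, Subsingleton.elim (v i c _) 0, Submodule.coe_zero, inner_zero_left]

theorem flux_sq_mul_measureReal_le (v : V M) (i : M.Sub) (c : M.Cell i) (k : Fin (M.dim i + 1)) :
    flux v.1 i c k ^ 2 * (μHE[M.dim i] : Measure (E n)).real (body (M.simplex i c)) ≤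
      (2 ^ (M.dim i + 3) + 2) * ∫ x in body (M.simplex i c), ‖v.1 i c x‖ ^ 2 ∂μHE[M.dim i] := by
  by_cases h0 : M.dim i = 0
  · rw [flux_eq_zero_of_dim_eq_zero _ h0, zero_pow two_ne_zero, zero_mul]
    exact mul_nonneg (by positivity) (integral_nonneg fun x => sq_nonneg _)
  · have : NeZero (M.dim i) := ⟨h0⟩
    exact inner_outwardNormal_sq_mul_measureReal_le (v.2.1 i c) k

instance finiteDimensional_V : FiniteDimensional ℝ (V M) := by
  let F : V M →ₗ[ℝ] (∀ i, M.Cell i → Fin (M.dim i + 1) → ℝ) :=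
    { toFun := fun v => flux v.1
      map_add' := fun u v => funext fun i => funext fun c => funext fun k =>
        normalTrace_add u.1 v.1 i c k _
      map_smul' := fun r v => funext fun i => funext fun c => funext fun k =>
        normalTrace_smul r v.1 i c k _ }
  refine FiniteDimensional.of_injective F ((injective_iff_map_eq_zero F).2 fun v hv => ?_)
  exact eq_zero_of_flux fun i c k => congrFun (congrFun (congrFun hv i) c) k

/-! ### Spectral equivalence of the mass form and its diagonal part -/

variable (P : Params M)

/-- The energy `(K⁻¹ v, v)_T` of a tangential field on a single cell. -/
def cellEnergy {i : M.Sub} (c : M.Cell i) (v : E n → M.dir i) : ℝ :=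
  ∫ x in body (M.simplex i c), inner ℝ ((P.K i).symm (v x)) (v x) ∂μHE[M.dim i]

theorem massForm_self (v : V M) : massForm P v v = ∑ i, ∑ c, cellEnergy P c (v.1 i c) := rfl

theorem diagMassForm_apply (u v : V M) : diagMassForm P u v = ∑ i, ∑ c, ∑ k,
    flux u.1 i c k * flux v.1 i c k *
      cellEnergy P c (rtBasis (M.dir i) (M.simplex i c) k) := rfl

theorem massForm_comm (u v : V M) : massForm P u v = massForm P v u := by
  refine Finset.sum_congr rfl fun i _ => Finset.sum_congr rfl fun c _ => ?_
  congr 1 with x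
  exact ((isPositive_K P i).toLinearMap_symm.isSymmetric _ _).trans (real_inner_comm _ _)

theorem diagMassForm_comm (u v : V M) : diagMassForm P u v = diagMassForm P v u := by
  simp only [diagMassForm_apply, mul_comm (flux u.1 _ _ _)]

section CellEnergy

variable {i : M.Sub} (c : M.Cell i)

theorem cellEnergy_nonneg (v : E n → M.dir i) : 0 ≤ cellEnergy P c v :=
  integral_nonneg fun _ => inner_K_symm_nonneg P i _

theorem integrableOn_inner_K_symm {v : E n → M.dir i} (hv : Continuous v) :
    IntegrableOn (fun x => (inner ℝ ((P.K i).symm (v x)) (v x) : ℝ))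
      (body (M.simplex i c)) μHE[M.dim i] :=
  integrableOn_body _
    (((P.K i).symm.toLinearMap.continuous_of_finiteDimensional.comp hv).inner hv)

theorem cellEnergy_smul (r : ℝ) (v : E n → M.dir i) :
    cellEnergy P c (r • v) = r ^ 2 * cellEnergy P c v := by
  rw [cellEnergy, cellEnergy, ← integral_const_mul]
  congr 1 with x
  rw [Pi.smul_apply, map_smul, real_inner_smul_left (F := M.dir i),
    real_inner_smul_right (F := M.dir i), ← mul_assoc, sq]

theorem cellEnergy_sum_le {ι : Type*} [Fintype ι] {w : ι → E n → M.dir i}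
    (hw : ∀ k, Continuous (w k)) :
    cellEnergy P c (∑ k, w k) ≤ Fintype.card ι * ∑ k, cellEnergy P c (w k) := by
  have hint k := integrableOn_inner_K_symm P c (hw k)
  unfold cellEnergy
  rw [← integral_finsetSum _ fun k _ => hint k, ← integral_const_mul]
  refine setIntegral_mono (integrableOn_inner_K_symm P c
    (by rw [Finset.sum_fn]; exact continuous_finsetSum _ fun k _ => hw k))
    ((integrable_finsetSum _ fun k _ => hint k).const_mul _) fun x => ?_
  rw [Finset.sum_apply]
  exact apply_sum_sum_le (innerₗ (M.dir i) ∘ₗ (P.K i).symm.toLinearMap)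
    (inner_K_symm_nonneg P i) fun k => w k x

variable {P c}

theorem integral_norm_sq_le_mul_cellEnergy {t : ℝ}
    (h : ∀ v : M.dir i, (inner ℝ (P.K i v) v : ℝ) ≤ t * ‖v‖ ^ 2)
    {v : E n → M.dir i} (hv : Continuous v) :
    ∫ x in body (M.simplex i c), ‖v x‖ ^ 2 ∂μHE[M.dim i] ≤ t * cellEnergy P c v := by
  rw [cellEnergy, ← integral_const_mul]
  exact setIntegral_mono (integrableOn_body _ (by fun_prop))
    ((integrableOn_inner_K_symm P c hv).const_mul t) fun x =>
      norm_sq_le_mul_inner_symm_apply_self (isPositive_K P i) h (v x)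

theorem norm_rtBasis_le_of_shapeRegular [NeZero (M.dim i)] {σ : ℝ} (hσ : M.ShapeRegular σ)
    (k : Fin (M.dim i + 1)) {x : E n} (hx : x ∈ body (M.simplex i c)) :
    ‖rtBasis (M.dir i) (M.simplex i c) k x‖ ≤ |σ| := by
  obtain ⟨z, hz, r, hr, hball, hdiam⟩ := hσ i c
  have hheight : 2 * r ≤ facetHeight (M.simplex i c) k := by
    rw [← M.affineSpan_simplex i c] at hz hball
    exact two_mul_le_facetHeight (M.simplex i c) k hz hr.le hball
  refine (norm_rtBasis_le _ k hx).trans ?_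
  rw [inv_mul_le_iff₀ (facetHeight_pos _ k), mul_comm]
  calc Metric.diam (body (M.simplex i c)) ≤ |σ| * (2 * r) :=
        hdiam.trans (by gcongr; exact le_abs_self σ)
    _ ≤ |σ| * facetHeight (M.simplex i c) k := by gcongr

theorem cellEnergy_rtBasis_le [NeZero (M.dim i)] {σ κ : ℝ} (hσ : M.ShapeRegular σ) (hκ : 0 < κ)
    (h : ∀ v : M.dir i, κ * ‖v‖ ^ 2 ≤ inner ℝ (P.K i v) v) (k : Fin (M.dim i + 1)) :
    cellEnergy P c (rtBasis (M.dir i) (M.simplex i c) k) ≤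
      κ⁻¹ * σ ^ 2 * (μHE[M.dim i] : Measure (E n)).real (body (M.simplex i c)) := by
  rw [mul_comm, ← smul_eq_mul, ← setIntegral_const]
  refine setIntegral_mono_on (integrableOn_inner_K_symm P c (continuous_rtBasis _ k))
    (integrableOn_const (measure_body_lt_top _).ne) (isCompact_body _).measurableSet fun x hx => ?_
  refine (inner_symm_apply_self_le hκ h _).trans ?_
  have hnorm := norm_rtBasis_le_of_shapeRegular hσ k hx
  rw [← sq_abs σ]
  gcongr

theorem flux_sq_mul_cellEnergy_rtBasis_le {σ τ : ℝ} (hσ : M.ShapeRegular σ)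
    (hτ : P.AnisotropyLE τ) (v : V M) (k : Fin (M.dim i + 1)) :
    flux v.1 i c k ^ 2 * cellEnergy P c (rtBasis (M.dir i) (M.simplex i c) k) ≤
      (2 ^ (M.dim i + 3) + 2) * σ ^ 2 * |τ| * cellEnergy P c (v.1 i c) := by
  have hnonneg := cellEnergy_nonneg P c (v.1 i c)
  by_cases h0 : M.dim i = 0
  · rw [flux_eq_zero_of_dim_eq_zero _ h0, zero_pow two_ne_zero, zero_mul]
    positivity
  have : NeZero (M.dim i) := ⟨h0⟩
  obtain ⟨κ, hκ, hK⟩ := hτ i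
  have hnorm : ∫ x in body (M.simplex i c), ‖v.1 i c x‖ ^ 2 ∂μHE[M.dim i] ≤
      |τ| * κ * cellEnergy P c (v.1 i c) :=
    integral_norm_sq_le_mul_cellEnergy (fun u => (hK u).2.trans (by gcongr; exact le_abs_self τ))
      (V_contDiff v i c).continuous
  calc flux v.1 i c k ^ 2 * cellEnergy P c (rtBasis (M.dir i) (M.simplex i c) k)
      ≤ flux v.1 i c k ^ 2 *
          (κ⁻¹ * σ ^ 2 * (μHE[M.dim i] : Measure (E n)).real (body (M.simplex i c))) := by
        gcongr
        exact cellEnergy_rtBasis_le hσ hκ (fun u => (hK u).1) k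
    _ = κ⁻¹ * σ ^ 2 *
          (flux v.1 i c k ^ 2 * (μHE[M.dim i] : Measure (E n)).real (body (M.simplex i c))) := by
        ring
    _ ≤ κ⁻¹ * σ ^ 2 * ((2 ^ (M.dim i + 3) + 2) * (|τ| * κ * cellEnergy P c (v.1 i c))) :=
        mul_le_mul_of_nonneg_left
          ((flux_sq_mul_measureReal_le v i c k).trans (by gcongr)) (by positivity)
    _ = (2 ^ (M.dim i + 3) + 2) * σ ^ 2 * |τ| * cellEnergy P c (v.1 i c) := by
        field_simp

theorem flux_eq_zero_of_cellEnergy_eq_zero (v : V M) (h : cellEnergy P c (v.1 i c) = 0)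
    (k : Fin (M.dim i + 1)) : flux v.1 i c k = 0 := by
  let T : M.dir i →L[ℝ] M.dir i := LinearMap.toContinuousLinearMap (P.K i : M.dir i →ₗ[ℝ] M.dir i)
  have hT (u : M.dir i) : inner ℝ (P.K i u) u ≤ ‖T‖ * ‖u‖ ^ 2 :=
    (real_inner_le_norm _ _).trans (by
      rw [sq, ← mul_assoc]
      exact mul_le_mul_of_nonneg_right (T.le_opNorm u) (norm_nonneg _))
  have hnorm := integral_norm_sq_le_mul_cellEnergy (c := c) hT (V_contDiff v i c).continuous
  rw [h, mul_zero] at hnorm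
  have hflux := (flux_sq_mul_measureReal_le v i c k).trans
    (mul_nonpos_of_nonneg_of_nonpos (by positivity) hnorm)
  exact pow_eq_zero_iff two_ne_zero |>.1 (le_antisymm
    (nonpos_of_mul_nonpos_left hflux (measureReal_body_pos _)) (sq_nonneg _))

end CellEnergy

theorem massForm_nonneg (v : V M) : 0 ≤ massForm P v v :=
  Finset.sum_nonneg fun _ _ => Finset.sum_nonneg fun c _ => cellEnergy_nonneg P c _

theorem massForm_self_le (v : V M) : massForm P v v ≤ (n + 1) * diagMassForm P v v := by
  rw [massForm_self, diagMassForm_apply, Finset.mul_sum]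
  refine Finset.sum_le_sum fun i _ => ?_
  rw [Finset.mul_sum]
  refine Finset.sum_le_sum fun c _ => ?_
  have hcard : (Fintype.card (Fin (M.dim i + 1)) : ℝ) ≤ n + 1 := by
    rw [Fintype.card_fin]
    exact_mod_cast Nat.succ_le_succ (M.dim_le i)
  have hsum := cellEnergy_sum_le P c fun k =>
    (continuous_rtBasis (D := M.dir i) (M.simplex i c) k).const_smul (flux v.1 i c k)
  simp only [← eq_sum_flux v i c, cellEnergy_smul, sq] at hsum
  exact hsum.trans (mul_le_mul_of_nonneg_right hcard (Finset.sum_nonneg fun k _ =>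
    mul_nonneg (mul_self_nonneg _) (cellEnergy_nonneg P c _)))

variable {P}

theorem diagMassForm_self_le {σ τ : ℝ} (hσ : M.ShapeRegular σ) (hτ : P.AnisotropyLE τ) (v : V M) :
    diagMassForm P v v ≤ (n + 1) * ((2 ^ (n + 3) + 2) * σ ^ 2 * |τ|) * massForm P v v := by
  rw [massForm_self, diagMassForm_apply, Finset.mul_sum]
  refine Finset.sum_le_sum fun i _ => ?_
  rw [Finset.mul_sum]
  refine Finset.sum_le_sum fun c _ => ?_
  have hdim : (M.dim i : ℝ) ≤ n := Nat.cast_le.2 (M.dim_le i)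
  have hnonneg := cellEnergy_nonneg P c (v.1 i c)
  calc ∑ k, flux v.1 i c k * flux v.1 i c k *
        cellEnergy P c (rtBasis (M.dir i) (M.simplex i c) k)
      ≤ ∑ _ : Fin (M.dim i + 1),
          (2 ^ (M.dim i + 3) + 2) * σ ^ 2 * |τ| * cellEnergy P c (v.1 i c) := by
        refine Finset.sum_le_sum fun k _ => ?_
        rw [← sq]
        exact flux_sq_mul_cellEnergy_rtBasis_le hσ hτ v k
    _ = (M.dim i + 1) * ((2 ^ (M.dim i + 3) + 2) * σ ^ 2 * |τ|) * cellEnergy P c (v.1 i c) := by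
        rw [Finset.sum_const, Finset.card_univ, Fintype.card_fin, nsmul_eq_mul]
        push_cast
        ring
    _ ≤ (n + 1) * ((2 ^ (n + 3) + 2) * σ ^ 2 * |τ|) * cellEnergy P c (v.1 i c) := by
        gcongr
        · norm_num
        · exact M.dim_le i

theorem massForm_pos {v : V M} (hv : v ≠ 0) : 0 < massForm P v v := by
  refine (massForm_nonneg P v).lt_of_ne fun h => hv (eq_zero_of_flux fun i c =>
    flux_eq_zero_of_cellEnergy_eq_zero (P := P) v ?_)
  have hsub : ∑ c, cellEnergy P c (v.1 i c) = 0 :=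
    (Finset.sum_eq_zero_iff_of_nonneg fun i _ => Finset.sum_nonneg fun c _ =>
      cellEnergy_nonneg P c (v.1 i c)).1 h.symm i (Finset.mem_univ i)
  exact (Finset.sum_eq_zero_iff_of_nonneg fun c _ => cellEnergy_nonneg P c (v.1 i c)).1 hsub c
    (Finset.mem_univ c)

/-! ### The mortar form -/

variable (P)

theorem mortarForm_apply (l μ : Lam M) : mortarForm P l μ = ∑ e, ∑ m, l e m * μ e m *
    ∫ x in body (M.msimplex e m), P.γ e * (P.Kν e x)⁻¹ ∂μHE[M.dim (M.low e)] := by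
  simp only [mortarForm, LinearMap.mk₂_apply, integral_mul_const]
  exact Finset.sum_congr rfl fun e _ => Finset.sum_congr rfl fun m _ => by ring

theorem mortarForm_comm (l μ : Lam M) : mortarForm P l μ = mortarForm P μ l := by
  simp only [mortarForm_apply, mul_comm (l _ _)]

theorem mortarWeight_pos (e : M.Iface) (m : M.MCell e) :
    0 < ∫ x in body (M.msimplex e m), P.γ e * (P.Kν e x)⁻¹ ∂μHE[M.dim (M.low e)] := by
  obtain ⟨a, b, ha, hab⟩ := P.Kν_bounds e
  have hb : 0 < b :=
    have h := hab m _ (points_mem_body (M.msimplex e m) 0)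
    ha.trans_le (h.1.trans h.2)
  have hmeas := (isCompact_body (M.msimplex e m)).measurableSet
  have hint : IntegrableOn (fun x => (P.Kν e x)⁻¹) (body (M.msimplex e m))
      μHE[M.dim (M.low e)] := by
    refine IntegrableOn.of_bound (measure_body_lt_top _)
      (P.Kν_measurable e).inv.aestronglyMeasurable a⁻¹
      ((ae_restrict_iff' hmeas).2 (.of_forall fun x hx => ?_))
    have h := (hab m x hx).1
    rw [Real.norm_of_nonneg (inv_nonneg.2 (ha.le.trans h))]
    exact inv_anti₀ ha h
  rw [integral_const_mul]
  refine mul_pos (P.γ_pos e) ?_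
  calc 0 < (μHE[M.dim (M.low e)] : Measure (E n)).real (body (M.msimplex e m)) * b⁻¹ :=
        mul_pos (measureReal_body_pos _) (inv_pos.2 hb)
    _ = ∫ _ in body (M.msimplex e m), b⁻¹ ∂μHE[M.dim (M.low e)] := by
        rw [setIntegral_const, smul_eq_mul]
    _ ≤ ∫ x in body (M.msimplex e m), (P.Kν e x)⁻¹ ∂μHE[M.dim (M.low e)] :=
        setIntegral_mono_on (integrableOn_const (measure_body_lt_top _).ne) hint hmeas fun x hx =>
          inv_anti₀ (ha.trans_le (hab m x hx).1) (hab m x hx).2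

theorem mortarForm_nonneg (μ : Lam M) : 0 ≤ mortarForm P μ μ := by
  rw [mortarForm_apply]
  exact Finset.sum_nonneg fun e _ => Finset.sum_nonneg fun m _ =>
    mul_nonneg (mul_self_nonneg _) (mortarWeight_pos P e m).le

variable {P}

theorem mortarForm_pos {μ : Lam M} (hμ : μ ≠ 0) : 0 < mortarForm P μ μ := by
  refine (mortarForm_nonneg P μ).lt_of_ne fun h => hμ (funext fun e => funext fun m => ?_)
  have hterm (e) (m : M.MCell e) := mul_nonneg (mul_self_nonneg (μ e m)) (mortarWeight_pos P e m).le
  rw [mortarForm_apply] at h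
  have he := (Finset.sum_eq_zero_iff_of_nonneg fun e _ => Finset.sum_nonneg fun m _ =>
    hterm e m).1 h.symm e (Finset.mem_univ e)
  have hm := (Finset.sum_eq_zero_iff_of_nonneg fun m _ => hterm e m).1 he m (Finset.mem_univ m)
  exact mul_self_eq_zero.1 ((mul_eq_zero_iff_right (mortarWeight_pos P e m).ne').1 hm)

/-! ### The forms on `W_h` -/

variable (P)

theorem aForm_apply (w r : W M) :
    aForm P w r = massForm P (total M w) (total M r) + mortarForm P w.2 r.2 := rfl

theorem aDForm_apply (w r : W M) :
    aDForm P w r = diagMassForm P (total M w) (total M r) + mortarForm P w.2 r.2 := rfl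

theorem aForm_comm (w r : W M) : aForm P w r = aForm P r w := by
  rw [aForm_apply, aForm_apply, massForm_comm, mortarForm_comm]

theorem aDForm_comm (w r : W M) : aDForm P w r = aDForm P r w := by
  rw [aDForm_apply, aDForm_apply, diagMassForm_comm, mortarForm_comm]

theorem aForm_self_le (r : W M) : aForm P r r ≤ (n + 1) * aDForm P r r := by
  rw [aForm_apply, aDForm_apply, mul_add]
  exact add_le_add (massForm_self_le P _)
    (le_mul_of_one_le_left (mortarForm_nonneg P r.2) (by simp))

variable {P}

theorem aDForm_self_le {σ τ : ℝ} (hσ : M.ShapeRegular σ) (hτ : P.AnisotropyLE τ) (r : W M) :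
    aDForm P r r ≤ ((n + 1) * ((2 ^ (n + 3) + 2) * σ ^ 2 * |τ|) + 1) * aForm P r r := by
  rw [aForm_apply, aDForm_apply, mul_add]
  refine add_le_add ((diagMassForm_self_le hσ hτ _).trans
    (mul_le_mul_of_nonneg_right (by linarith) (massForm_nonneg P _)))
    (le_mul_of_one_le_left (mortarForm_nonneg P r.2) ?_)
  exact le_add_of_nonneg_left (by positivity)

theorem aForm_pos {r : W M} (hr : r ≠ 0) : 0 < aForm P r r := by
  rw [aForm_apply]
  by_cases h : r.2 = 0
  · have ht : total M r ≠ 0 := fun h0 =>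
      hr (Prod.ext (Subtype.ext (by simpa [total, h] using h0)) h)
    exact add_pos_of_pos_of_nonneg (massForm_pos ht) (mortarForm_nonneg P _)
  · exact add_pos_of_nonneg_of_pos (massForm_nonneg P _) (mortarForm_pos h)

end

/-! ### The divergence in terms of fluxes -/

theorem facet_eq_empty {n d : ℕ} (hd : d = 0) (s : Affine.Simplex ℝ (E n) d) (k : Fin (d + 1)) :
    facet s k = ∅ := by
  have hk : ({k}ᶜ : Set (Fin (d + 1))) = ∅ :=
    Set.compl_empty_iff.2 (Set.eq_univ_of_forall fun a => Fin.ext (by omega))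
  rw [facet, hk, Set.image_empty, convexHull_empty]

theorem hasFDerivAt_rtBasis {n d : ℕ} {D : Submodule ℝ (E n)} (s : Affine.Simplex ℝ (E n) d)
    (k : Fin (d + 1)) (x : E n) :
    HasFDerivAt (rtBasis D s k) ((facetHeight s k)⁻¹ • D.orthogonalProjectionOnto) x := by
  have h := (D.orthogonalProjectionOnto.hasFDerivAt.comp x
    ((hasFDerivAt_id x).sub_const (s.points k))).const_smul (facetHeight s k)⁻¹
  rw [ContinuousLinearMap.comp_id] at h
  exact h

theorem tangentialDiv_sum_smul_rtBasis {n d : ℕ} {D : Submodule ℝ (E n)}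
    (s : Affine.Simplex ℝ (E n) d) (g : Fin (d + 1) → ℝ) (x : E n) :
    tangentialDiv (∑ k, g k • rtBasis D s k) x =
      (∑ k, g k * (facetHeight s k)⁻¹) * Module.finrank ℝ D := by
  have hderiv := HasFDerivAt.sum fun k (_ : k ∈ Finset.univ) =>
    (hasFDerivAt_rtBasis (D := D) s k x).const_smul (g k)
  simp only [smul_smul, ← Finset.sum_smul] at hderiv
  have htrace (t : ℝ) : (t • D.orthogonalProjectionOnto).toLinearMap ∘ₗ D.subtype =
      t • LinearMap.id := by
    ext y
    simp
  rw [tangentialDiv, hderiv.fderiv, htrace, map_smul, LinearMap.trace_id, smul_eq_mul]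

noncomputable section

variable {n : ℕ} {M : MixedDimMesh n}

/-- The `(d - 1)`-dimensional area of a facet of a `d`-dimensional cell (zero for `d = 0`). -/
def facetArea (i : M.Sub) (c : M.Cell i) (k : Fin (M.dim i + 1)) : ℝ :=
  (μHE[M.dim i - 1] : Measure (E n)).real (facet (M.simplex i c) k)

theorem facetArea_nonneg (i : M.Sub) (c : M.Cell i) (k : Fin (M.dim i + 1)) :
    0 ≤ facetArea i c k :=
  measureReal_nonneg

theorem facetArea_eq_zero {i : M.Sub} (h : M.dim i = 0) (c : M.Cell i) (k : Fin (M.dim i + 1)) :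
    facetArea i c k = 0 := by
  rw [facetArea, facet_eq_empty h, measureReal_empty]

theorem facetArea_pos {i : M.Sub} (h : M.dim i ≠ 0) (c : M.Cell i) (k : Fin (M.dim i + 1)) :
    0 < facetArea i c k :=
  have : NeZero (M.dim i) := ⟨h⟩
  ENNReal.toReal_pos (measure_facet_pos _ k).ne' (measure_facet_lt_top _ k).ne

theorem inv_facetHeight_mul_measureReal_body (i : M.Sub) (c : M.Cell i) (k : Fin (M.dim i + 1)) :
    (facetHeight (M.simplex i c) k)⁻¹ * M.dim i *
      (μHE[M.dim i] : Measure (E n)).real (body (M.simplex i c)) = facetArea i c k := by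
  by_cases h0 : M.dim i = 0
  · rw [facetArea_eq_zero h0, Nat.cast_eq_zero.2 h0, mul_zero, zero_mul]
  · have : NeZero (M.dim i) := ⟨h0⟩
    exact (measureReal_facet_eq _ k).symm

theorem integral_tangentialDiv (v : V M) (i : M.Sub) (c : M.Cell i) :
    ∫ x in body (M.simplex i c), tangentialDiv (v.1 i c) x ∂μHE[M.dim i] =
      ∑ k, flux v.1 i c k * facetArea i c k := by
  rw [eq_sum_flux v i c]
  simp only [tangentialDiv_sum_smul_rtBasis, finrank_dir, setIntegral_const, smul_eq_mul,
    ← inv_facetHeight_mul_measureReal_body, Finset.sum_mul, Finset.mul_sum]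
  exact Finset.sum_congr rfl fun k _ => by ring

theorem integrableOn_tangentialDiv (v : V M) (i : M.Sub) (c : M.Cell i) :
    IntegrableOn (tangentialDiv (v.1 i c)) (body (M.simplex i c)) μHE[M.dim i] := by
  rw [eq_sum_flux v i c, funext (tangentialDiv_sum_smul_rtBasis _ _)]
  exact integrableOn_const (measure_body_lt_top _).ne

theorem bForm_apply (r : W M) (p : Q M) :
    bForm M r p = -∑ i, ∑ c, p i c * ((∑ k, flux (total M r).1 i c k * facetArea i c k) +
      ∫ x in body (M.simplex i c), jump r.2 i x ∂μHE[M.dim i]) := by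
  simp only [bForm, LinearMap.mk₂_apply, integral_const_mul, mixedDiv]
  congr! 6 with i _ c
  rw [integral_add (integrableOn_tangentialDiv _ i c) (integrableOn_jump _ _ _),
    integral_tangentialDiv]

theorem flux_ofFlux_mul_facetArea (g : ∀ i, M.Cell i → Fin (M.dim i + 1) → ℝ) (i : M.Sub)
    (c : M.Cell i) (k : Fin (M.dim i + 1)) :
    flux (ofFlux g) i c k * facetArea i c k = g i c k * facetArea i c k := by
  by_cases h0 : M.dim i = 0
  · rw [facetArea_eq_zero h0, mul_zero, mul_zero]
  · have : NeZero (M.dim i) := ⟨h0⟩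
    rw [flux, normalTrace_ofFlux g i c k (facetBarycenter_mem_facet _ k)]

theorem exists_bForm_eq (g : ∀ i, M.Cell i → Fin (M.dim i + 1) → ℝ)
    (hinterior : ∀ i c k c' k', M.kind i c k = .interior c' k' → g i c k + g i c' k' = 0)
    (hneumann : ∀ i c k, M.kind i c k = .neumann → g i c k = 0)
    (hmortar : ∀ i c k e, M.kind i c k = .mortar e → g i c k = 0) :
    ∃ r : W M, ∀ p, bForm M r p = -∑ i, ∑ c, p i c * ∑ k, g i c k * facetArea i c k := by
  let v : V M := ⟨ofFlux g, ofFlux_mem hinterior hneumann⟩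
  have hv : v ∈ V0 M := fun i c k e hk x hx => by
    rw [normalTrace_ofFlux g i c k hx, hmortar i c k e hk]
  refine ⟨(⟨v, hv⟩, 0), fun p => ?_⟩
  have htotal : total M (⟨v, hv⟩, 0) = v := by simp [total]
  have hjump (i : M.Sub) (x : E n) : jump (0 : Lam M) i x = 0 := by
    simpa using jump_smul 0 (0 : Lam M) i x
  simp only [bForm_apply, htotal, hjump, integral_zero, add_zero, v, flux_ofFlux_mul_facetArea]

/-! ### Pressures orthogonal to the divergences of `V_{0h}` -/

/-- The jump of a pressure across a facet, where the pressure vanishes outside the Dirichlet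
boundary; it is set to zero on no-flow facets and on interfaces. -/
def pressureJump (p : Q M) (i : M.Sub) (c : M.Cell i) (k : Fin (M.dim i + 1)) : ℝ :=
  match M.kind i c k with
  | .interior c' _ => p i c - p i c'
  | .dirichlet => p i c
  | _ => 0

/-- The same facet seen from the cell on its other side, if there is one in the same subdomain. -/
def oppositeFacet (i : M.Sub) (x : M.Cell i × Fin (M.dim i + 1)) : M.Cell i × Fin (M.dim i + 1) :=
  match M.kind i x.1 x.2 with
  | .interior c' k' => (c', k')
  | _ => x

theorem oppositeFacet_involutive (i : M.Sub) : Function.Involutive (oppositeFacet i) := by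
  rintro ⟨c, k⟩
  cases h : M.kind i c k with
  | interior c' k' => simp [oppositeFacet, h, M.interior_symm i c k c' k' h]
  | _ => simp [oppositeFacet, h]

theorem pressureJump_sq_mul_facetArea_le (p : Q M) (i : M.Sub)
    (x : M.Cell i × Fin (M.dim i + 1)) :
    pressureJump p i x.1 x.2 ^ 2 * facetArea i x.1 x.2 ≤
      p i x.1 * (pressureJump p i x.1 x.2 * facetArea i x.1 x.2) +
        p i (oppositeFacet i x).1 * (pressureJump p i (oppositeFacet i x).1 (oppositeFacet i x).2 *
          facetArea i (oppositeFacet i x).1 (oppositeFacet i x).2) := by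
  obtain ⟨c, k⟩ := x
  cases h : M.kind i c k with
  | interior c' k' =>
    have harea : facetArea i c' k' = facetArea i c k := by
      rw [facetArea, facetArea, (M.interior_shared i c k c' k' h).2]
    simp only [pressureJump, oppositeFacet, h, M.interior_symm i c k c' k' h, harea]
    exact le_of_eq (by ring)
  | dirichlet =>
    simp only [pressureJump, oppositeFacet, h]
    nlinarith [mul_nonneg (sq_nonneg (p i c)) (facetArea_nonneg i c k)]
  | _ => simp [pressureJump, oppositeFacet, h]

theorem sum_pressureJump_sq_le (p : Q M) (i : M.Sub) :
    ∑ c, ∑ k, pressureJump p i c k ^ 2 * facetArea i c k ≤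
      2 * ∑ c, p i c * ∑ k, pressureJump p i c k * facetArea i c k := by
  have hfacets := Finset.sum_le_sum fun x (_ : x ∈ Finset.univ) =>
    pressureJump_sq_mul_facetArea_le p i x
  have hopposite := Equiv.sum_comp (oppositeFacet_involutive i).toPerm fun x =>
    p i x.1 * (pressureJump p i x.1 x.2 * facetArea i x.1 x.2)
  rw [Finset.sum_add_distrib] at hfacets
  simp only [Function.Involutive.coe_toPerm] at hopposite
  rw [hopposite, ← two_mul] at hfacets
  simpa only [Fintype.sum_prod_type, Finset.mul_sum] using hfacets

theorem pressureJump_eq_zero {p : Q M} (hp : ∀ r, bForm M r p = 0) (i : M.Sub) (c : M.Cell i)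
    (k : Fin (M.dim i + 1)) : pressureJump p i c k = 0 := by
  by_cases h0 : M.dim i = 0
  · rw [pressureJump, M.kind_point i c k h0]
  obtain ⟨r, hr⟩ := exists_bForm_eq (pressureJump p)
    (fun i c k c' k' h => by simp [pressureJump, h, M.interior_symm i c k c' k' h])
    (fun i c k h => by simp [pressureJump, h]) (fun i c k e h => by simp [pressureJump, h])
  have hterm (i c k) : 0 ≤ pressureJump p i c k ^ 2 * facetArea i c k :=
    mul_nonneg (sq_nonneg _) (facetArea_nonneg i c k)
  have hsum : ∑ i, ∑ c, ∑ k, pressureJump p i c k ^ 2 * facetArea i c k ≤ 0 := by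
    refine (Finset.sum_le_sum fun i _ => sum_pressureJump_sq_le p i).trans_eq ?_
    rw [← Finset.mul_sum, neg_eq_zero.1 ((hr p).symm.trans (hp r)), mul_zero]
  have hle : pressureJump p i c k ^ 2 * facetArea i c k ≤ 0 :=
    (Finset.single_le_sum (fun k _ => hterm i c k) (Finset.mem_univ k)).trans <|
      (Finset.single_le_sum (fun c _ => Finset.sum_nonneg fun k _ => hterm i c k)
        (Finset.mem_univ c)).trans <|
      (Finset.single_le_sum (fun i _ => Finset.sum_nonneg fun c _ =>
        Finset.sum_nonneg fun k _ => hterm i c k) (Finset.mem_univ i)).trans hsum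
  exact pow_eq_zero_iff two_ne_zero |>.1
    (le_antisymm (nonpos_of_mul_nonpos_left hle (facetArea_pos h0 c k)) (sq_nonneg _))

/-! ### Coupling through the interfaces -/

theorem sum_measureReal_of_pairwise_aedisjoint {α ι : Type*} [Fintype ι] [MeasurableSpace α]
    {μ : Measure α} {s : ι → Set α} (hd : Pairwise fun i j => AEDisjoint μ (s i) (s j))
    (hm : ∀ i, NullMeasurableSet (s i) μ) (hfin : ∀ i, μ (s i) ≠ ⊤) :
    ∑ i, μ.real (s i) = μ.real (⋃ i, s i) := by
  rw [← measureReal_biUnion_finset₀ (fun i _ j _ h => hd h) (fun i _ => hm i) fun i _ => hfin i]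
  simp only [Finset.mem_univ, Set.iUnion_true]

theorem sum_measureReal_inter_msimplex (e : M.Iface) {S : Set (E n)} (hS : MeasurableSet S)
    (hsub : S ⊆ ⋃ c, body (M.simplex (M.low e) c)) :
    ∑ m, (μHE[M.dim (M.low e)] : Measure (E n)).real (S ∩ body (M.msimplex e m)) =
      (μHE[M.dim (M.low e)] : Measure (E n)).real S := by
  rw [sum_measureReal_of_pairwise_aedisjoint
    (fun m m' hm => measure_mono_null
      (Set.inter_subset_inter Set.inter_subset_right Set.inter_subset_right)
      (measure_body_inter_eq_zero _ _ (M.msimplex_disjoint e hm)))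
    (fun m => (hS.inter (isCompact_body _).measurableSet).nullMeasurableSet)
    fun m => ((measure_mono Set.inter_subset_right).trans_lt (measure_body_lt_top _)).ne]
  rw [← Set.inter_iUnion, M.msimplex_cover e, Set.inter_eq_left.2 hsub]

/-- The area of an interface, that is, of the lower-dimensional subdomain on which it lies. -/
def ifaceArea (e : M.Iface) : ℝ :=
  (μHE[M.dim (M.low e)] : Measure (E n)).real (⋃ c, body (M.simplex (M.low e) c))

theorem sum_measureReal_cells (e : M.Iface) :
    ∑ c, (μHE[M.dim (M.low e)] : Measure (E n)).real (body (M.simplex (M.low e) c)) =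
      ifaceArea e :=
  sum_measureReal_of_pairwise_aedisjoint
    (fun c c' hc => measure_body_inter_eq_zero _ _
      (M.disjoint_cells (i := ⟨_, c⟩) (j := ⟨_, c'⟩) (by simpa using hc)))
    (fun _ => (isCompact_body _).measurableSet.nullMeasurableSet)
    fun _ => (measure_body_lt_top _).ne

theorem ifaceArea_pos (e : M.Iface) : 0 < ifaceArea e := by
  rw [← sum_measureReal_cells]
  exact Finset.sum_pos (fun _ _ => measureReal_body_pos _) Finset.univ_nonempty

theorem dim_up_ne_zero (e : M.Iface) : M.dim (M.up e) ≠ 0 := by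
  rw [M.dim_up]
  exact Nat.succ_ne_zero _

theorem dim_up_sub_one (e : M.Iface) : M.dim (M.up e) - 1 = M.dim (M.low e) := by
  rw [M.dim_up, Nat.add_sub_cancel]

open Classical in
theorem sum_facetArea (e : M.Iface) :
    ∑ c, ∑ k, (if M.kind (M.up e) c k = .mortar e then facetArea (M.up e) c k else 0) =
      ifaceArea e := by
  have : NeZero (M.dim (M.up e)) := ⟨dim_up_ne_zero e⟩
  let S : Finset (M.Cell (M.up e) × Fin (M.dim (M.up e) + 1)) :=
    {x | M.kind (M.up e) x.1 x.2 = .mortar e}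
  have hunion : ⋃ x ∈ S, facet (M.simplex (M.up e) x.1) x.2 =
      ⋃ c, body (M.simplex (M.low e) c) := by
    rw [← M.mortar_cover e]
    ext x
    simp [S]
  calc ∑ c, ∑ k, (if M.kind (M.up e) c k = .mortar e then facetArea (M.up e) c k else 0)
      = ∑ x ∈ S, facetArea (M.up e) x.1 x.2 := by
        rw [Finset.sum_filter, Fintype.sum_prod_type]
    _ = (μHE[M.dim (M.up e) - 1] : Measure (E n)).real
          (⋃ x ∈ S, facet (M.simplex (M.up e) x.1) x.2) := by
        refine (measureReal_biUnion_finset₀ (fun x hx y hy hxy => ?_)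
          (fun x _ => (isCompact_facet _ _).measurableSet.nullMeasurableSet)
          fun x _ => (measure_facet_lt_top _ _).ne).symm
        exact measure_inter_eq_zero (convex_facet _ _) (convex_facet _ _)
          (finrank_vectorSpan_facet _ _) (finrank_vectorSpan_facet _ _)
          (M.mortar_disjoint e (i := ⟨x, (Finset.mem_filter.1 hx).2⟩)
            (j := ⟨y, (Finset.mem_filter.1 hy).2⟩) (by simpa using hxy))
    _ = ifaceArea e := by rw [hunion, dim_up_sub_one, ifaceArea]

open Classical in
/-- The characteristic function of an interface, as a mortar variable. -/
def ifaceIndicator (e : M.Iface) : Lam M := fun e' _ => if e' = e then 1 else 0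

theorem proj_ifaceIndicator_of_ne {e e' : M.Iface} (h : e' ≠ e) (f : Set (E n)) :
    proj (ifaceIndicator e) e' f = 0 := by
  simp [proj, ifaceIndicator, h]

theorem proj_ifaceIndicator_self {e : M.Iface} {c : M.Cell (M.up e)}
    {k : Fin (M.dim (M.up e) + 1)} (h : M.kind (M.up e) c k = .mortar e) :
    proj (ifaceIndicator e) e (facet (M.simplex (M.up e) c) k) = 1 := by
  have hsub : facet (M.simplex (M.up e) c) k ⊆ ⋃ c, body (M.simplex (M.low e) c) := by
    rw [← M.mortar_cover e]
    exact Set.subset_iUnion_of_subset c (Set.subset_iUnion₂_of_subset k h subset_rfl)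
  have hpos := facetArea_pos (dim_up_ne_zero e) c k
  rw [facetArea, dim_up_sub_one] at hpos
  simp only [proj, ifaceIndicator, if_true, one_mul]
  rw [← Finset.sum_div, sum_measureReal_inter_msimplex e (isCompact_facet _ _).measurableSet hsub,
    div_self hpos.ne']

open Classical in
theorem extCoeff_ifaceIndicator (e : M.Iface) (i : M.Sub) (c : M.Cell i) (k : Fin (M.dim i + 1)) :
    extCoeff (ifaceIndicator e) i c k = if M.kind i c k = .mortar e then 1 else 0 := by
  cases hk : M.kind i c k with
  | mortar e' =>
    simp only [extCoeff, hk, FacetKind.mortar.injEq]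
    split_ifs with h
    · subst h
      obtain rfl := M.mortar_up i c k e' hk
      exact proj_ifaceIndicator_self hk
    · exact proj_ifaceIndicator_of_ne h _
  | _ => simp [extCoeff, hk]

open Classical in
theorem sum_extCoeff_ifaceIndicator (e : M.Iface) (i : M.Sub) :
    ∑ c, ∑ k, extCoeff (ifaceIndicator e) i c k * facetArea i c k =
      if i = M.up e then ifaceArea e else 0 := by
  simp only [extCoeff_ifaceIndicator, ite_mul, one_mul, zero_mul]
  split_ifs with hi
  · subst hi
    exact sum_facetArea e
  · have hkind (c k) : M.kind i c k ≠ .mortar e := fun hk => hi (M.mortar_up i c k e hk)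
    simp [hkind]

theorem integral_mortarFun_ifaceIndicator (e : M.Iface) (c : M.Cell (M.low e)) :
    ∫ x in body (M.simplex (M.low e) c), mortarFun (ifaceIndicator e) e x
      ∂μHE[M.dim (M.low e)] =
      (μHE[M.dim (M.low e)] : Measure (E n)).real (body (M.simplex (M.low e) c)) := by
  have hmeas m : MeasurableSet (body (M.msimplex e m)) := (isCompact_body _).measurableSet
  have hint m : IntegrableOn ((body (M.msimplex e m)).indicator fun _ => ifaceIndicator e e m)
      (body (M.simplex (M.low e) c)) μHE[M.dim (M.low e)] :=
    (integrableOn_const (measure_body_lt_top _).ne).indicator (hmeas m)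
  simp only [mortarFun]
  rw [integral_finsetSum _ fun m _ => hint m]
  simp only [setIntegral_indicator (hmeas _), setIntegral_const, ifaceIndicator, if_true,
    smul_eq_mul, mul_one]
  exact sum_measureReal_inter_msimplex e (isCompact_body _).measurableSet
    (Set.subset_iUnion (fun c => body (M.simplex (M.low e) c)) c)

open Classical in
theorem jump_ifaceIndicator (e : M.Iface) (i : M.Sub) (x : E n) :
    jump (ifaceIndicator e) i x =
      -if i = M.low e then mortarFun (ifaceIndicator e) e x else 0 := by
  rw [jump, Finset.sum_eq_single e (fun e' _ he => by simp [mortarFun, ifaceIndicator, he])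
    (by simp)]
  simp only [eq_comm]

open Classical in
theorem sum_integral_jump_ifaceIndicator (e : M.Iface) (i : M.Sub) :
    ∑ c, ∫ x in body (M.simplex i c), jump (ifaceIndicator e) i x ∂μHE[M.dim i] =
      -if i = M.low e then ifaceArea e else 0 := by
  simp only [jump_ifaceIndicator, integral_neg, Finset.sum_neg_distrib]
  split_ifs with hi
  · subst hi
    simp only [integral_mortarFun_ifaceIndicator, sum_measureReal_cells]
  · simp only [integral_zero, Finset.sum_const_zero]

theorem bForm_ifaceIndicator (e : M.Iface) (π : M.Sub → ℝ) :
    bForm M (0, ifaceIndicator e) (fun i _ => π i) =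
      (π (M.low e) - π (M.up e)) * ifaceArea e := by
  classical
  have htotal : (total M (0, ifaceIndicator e)).1 = ofFlux (extCoeff (ifaceIndicator e)) := by
    ext i c x
    simp [total, ext, extField, ofFlux]
  simp only [bForm_apply, htotal, flux_ofFlux_mul_facetArea, ← Finset.mul_sum,
    Finset.sum_add_distrib, sum_extCoeff_ifaceIndicator, sum_integral_jump_ifaceIndicator, mul_add,
    mul_neg, mul_ite, mul_zero, Finset.sum_neg_distrib, Finset.sum_ite_eq', Finset.mem_univ,
    if_true]
  ring

theorem eq_zero_of_bForm {p : Q M} (hp : ∀ r, bForm M r p = 0) : p = 0 := by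
  have hcells (i : M.Sub) (c c' : M.Cell i) : p i c = p i c' := by
    refine ((eq_equivalence.comap (p i)).eqvGen_iff).1 ((M.sub_connected i c c').mono ?_)
    rintro a b ⟨k, k', h⟩
    have hjump := pressureJump_eq_zero hp i a k
    rw [pressureJump, h] at hjump
    exact sub_eq_zero.1 hjump
  let π (i : M.Sub) : ℝ := p i (Classical.arbitrary _)
  have hπ : p = fun i _ => π i := funext fun i => funext fun c => hcells i c _
  have hsubs (i j : M.Sub) : π i = π j := by
    refine ((eq_equivalence.comap π).eqvGen_iff).1 ((M.connected i j).mono ?_)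
    rintro _ _ ⟨e, rfl, rfl⟩
    have hjump := hp (0, ifaceIndicator e)
    rw [hπ, bForm_ifaceIndicator] at hjump
    exact (sub_eq_zero.1 ((mul_eq_zero_iff_right (ifaceArea_pos e).ne').1 hjump)).symm
  obtain ⟨i, c, k, -, hk⟩ := M.exists_dirichlet
  have hdirichlet := pressureJump_eq_zero hp i c k
  simp only [pressureJump, hk] at hdirichlet
  funext j d
  rw [hcells j d (Classical.arbitrary _), Pi.zero_apply, Pi.zero_apply, ← hdirichlet,
    hcells i c (Classical.arbitrary _)]
  exact hsubs j i

end

/-! ### Inverses and operator norms -/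

section Inverse

variable {U U' : Type} [AddCommMonoid U] [Module ℝ U] [AddCommMonoid U'] [Module ℝ U']
  {T : U →ₗ[ℝ] U'}

theorem inv_eq_symm_ofBijective (h : Function.Bijective T) :
    inv T = (LinearEquiv.ofBijective T h).symm.toLinearMap :=
  dif_pos h

theorem apply_inv (h : Function.Bijective T) (y : U') : T (inv T y) = y := by
  rw [inv_eq_symm_ofBijective h]
  exact (LinearEquiv.ofBijective T h).apply_symm_apply y

theorem bijective_inv (h : Function.Bijective T) : Function.Bijective (inv T) := by
  rw [inv_eq_symm_ofBijective h]
  exact (LinearEquiv.ofBijective T h).symm.bijective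

theorem opNorm_le {N : U → ℝ} {T : U →ₗ[ℝ] U} {C : ℝ} (hC : 0 ≤ C) (h : ∀ x, N (T x) ≤ C * N x) :
    opNorm N T ≤ ENNReal.ofReal C := by
  refine iSup_le fun x => ENNReal.div_le_of_le_mul ?_
  rw [← ENNReal.ofReal_mul hC]
  exact ENNReal.ofReal_le_ofReal (h x)

theorem condNumber_le_of_bijective {N : U → ℝ} {T : U →ₗ[ℝ] U} (hT : Function.Bijective T)
    {α β : ℝ} (hα : 0 ≤ α) (hβ : 0 < β) (hupper : ∀ x, N (T x) ≤ α * N x)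
    (hlower : ∀ x, β * N x ≤ N (T x)) : condNumber N T ≤ ENNReal.ofReal (α / β) := by
  have hinv (y : U) : N (inv T y) ≤ β⁻¹ * N y := by
    rw [inv_mul_eq_div, le_div_iff₀' hβ]
    simpa only [apply_inv hT] using hlower (inv T y)
  rw [condNumber, div_eq_mul_inv, ENNReal.ofReal_mul hα]
  exact mul_le_mul' (opNorm_le hα hupper) (opNorm_le (inv_nonneg.2 hβ.le) hinv)

end Inverse

/-! ### Symmetric positive forms -/

section Forms

variable {U : Type*} [AddCommGroup U] [Module ℝ U] {B : U →ₗ[ℝ] U →ₗ[ℝ] ℝ}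

theorem bijective_of_apply_self_ne_zero [FiniteDimensional ℝ U] (h : ∀ u, u ≠ 0 → B u u ≠ 0) :
    Function.Bijective (B : U →ₗ[ℝ] Module.Dual ℝ U) := by
  have hinj : Function.Injective (B : U →ₗ[ℝ] Module.Dual ℝ U) :=
    (injective_iff_map_eq_zero _).2 fun u hu =>
      by_contra fun hu0 => h u hu0 (LinearMap.congr_fun hu u)
  exact ⟨hinj, (LinearMap.injective_iff_surjective_of_finrank_eq_finrank
    Subspace.dual_finrank_eq.symm).1 hinj⟩

theorem apply_self_nonneg_of_pos (h : ∀ u, u ≠ 0 → 0 < B u u) (u : U) : 0 ≤ B u u := by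
  obtain rfl | hu := eq_or_ne u 0
  · rw [map_zero]
  · exact (h u hu).le

theorem abs_apply_le_sqrt_mul_sqrt (hsymm : ∀ u v, B u v = B v u) (hnonneg : ∀ u, 0 ≤ B u u)
    (u v : U) : |B u v| ≤ √(B u u) * √(B v v) := by
  rw [← Real.sqrt_mul (hnonneg u)]
  exact Real.abs_le_sqrt (LinearMap.BilinForm.apply_sq_le_of_symm B hnonneg ⟨hsymm⟩ u v)

theorem apply_add_self (hsymm : ∀ u v, B u v = B v u) (u v : U) :
    B (u + v) (u + v) = B u u + 2 * B v u + B v v := by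
  simp only [map_add, LinearMap.add_apply, hsymm u v]
  ring

theorem two_mul_abs_apply_le (hsymm : ∀ u v, B u v = B v u) (hnonneg : ∀ u, 0 ≤ B u u) (u v : U) :
    2 * |B v u| ≤ B u u + B v v := by
  have hadd := hnonneg (u + v)
  have hsub := hnonneg (u + -v)
  rw [apply_add_self hsymm] at hadd hsub
  simp only [map_neg, LinearMap.neg_apply] at hsub
  rcases abs_cases (B v u) with ⟨h, -⟩ | ⟨h, -⟩ <;> linarith

end Forms

/-! ### Saddle point problems with a block diagonal preconditioner -/

noncomputable section

variable {W Q : Type} [AddCommGroup W] [Module ℝ W] [AddCommGroup Q] [Module ℝ Q]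

/-- The forms of a saddle point problem: `a` and its approximation `d` are symmetric and positive
definite, and `b` is nondegenerate in its second argument. -/
structure IsSaddle (a d : W →ₗ[ℝ] W →ₗ[ℝ] ℝ) (b : W →ₗ[ℝ] Q →ₗ[ℝ] ℝ) : Prop where
  a_symm : ∀ w r, a w r = a r w
  d_symm : ∀ w r, d w r = d r w
  a_pos : ∀ r, r ≠ 0 → 0 < a r r
  d_pos : ∀ r, r ≠ 0 → 0 < d r r
  eq_zero : ∀ p, (∀ r, b r p = 0) → p = 0

/-- The gradient `d⁻¹ bᵀ`; for the forms of the discrete problem this is `discGrad`. -/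
def saddleGrad (d : W →ₗ[ℝ] W →ₗ[ℝ] ℝ) (b : W →ₗ[ℝ] Q →ₗ[ℝ] ℝ) : Q →ₗ[ℝ] W :=
  inv (U' := Module.Dual ℝ W) d ∘ₗ b.flip

/-- The Schur complement `b d⁻¹ bᵀ` of the approximation; it specialises to `opS`. -/
def saddleSchur (d : W →ₗ[ℝ] W →ₗ[ℝ] ℝ) (b : W →ₗ[ℝ] Q →ₗ[ℝ] ℝ) : Q →ₗ[ℝ] Module.Dual ℝ Q :=
  b ∘ₗ saddleGrad d b

/-- The operator `(a, bᵀ; -b, 0)` of the saddle point problem; it specialises to `sysOp`. -/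
def saddleOp (a : W →ₗ[ℝ] W →ₗ[ℝ] ℝ) (b : W →ₗ[ℝ] Q →ₗ[ℝ] ℝ) :
    W × Q →ₗ[ℝ] Module.Dual ℝ W × Module.Dual ℝ Q :=
  (a.coprod b.flip).prod ((-b).coprod 0)

/-- The block diagonal preconditioner `diag(a, b d⁻¹ bᵀ)⁻¹`; it specialises to `precond`. -/
def saddlePrecond (a d : W →ₗ[ℝ] W →ₗ[ℝ] ℝ) (b : W →ₗ[ℝ] Q →ₗ[ℝ] ℝ) :
    Module.Dual ℝ W × Module.Dual ℝ Q →ₗ[ℝ] W × Q :=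
  inv (LinearMap.prodMap (M₃ := Module.Dual ℝ W) a (saddleSchur d b))

/-- The inner product that induces the weighted norm. -/
def saddleInner (a d : W →ₗ[ℝ] W →ₗ[ℝ] ℝ) (b : W →ₗ[ℝ] Q →ₗ[ℝ] ℝ) :
    W × Q →ₗ[ℝ] W × Q →ₗ[ℝ] ℝ :=
  a.compl₁₂ (LinearMap.fst ℝ _ _) (LinearMap.fst ℝ _ _) +
    d.compl₁₂ (saddleGrad d b ∘ₗ LinearMap.snd ℝ _ _) (saddleGrad d b ∘ₗ LinearMap.snd ℝ _ _)

/-- The weighted norm; it specialises to `triNorm`. -/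
def saddleNorm (a d : W →ₗ[ℝ] W →ₗ[ℝ] ℝ) (b : W →ₗ[ℝ] Q →ₗ[ℝ] ℝ) (x : W × Q) : ℝ :=
  √(a x.1 x.1 + d (saddleGrad d b x.2) (saddleGrad d b x.2))

/-- The composite form `ℒ`; it specialises to `compForm`. -/
def saddleComp (a d : W →ₗ[ℝ] W →ₗ[ℝ] ℝ) (b : W →ₗ[ℝ] Q →ₗ[ℝ] ℝ) (x y : W × Q) : ℝ :=
  a x.1 y.1 + d (saddleGrad d b x.2) y.1 + d (saddleGrad d b y.2) x.1

variable {a d : W →ₗ[ℝ] W →ₗ[ℝ] ℝ} {b : W →ₗ[ℝ] Q →ₗ[ℝ] ℝ}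

theorem saddleInner_apply (x y : W × Q) : saddleInner a d b x y =
    a x.1 y.1 + d (saddleGrad d b x.2) (saddleGrad d b y.2) :=
  rfl

theorem saddleOp_fst (x : W × Q) (r : W) : (saddleOp a b x).1 r = a x.1 r + b r x.2 :=
  rfl

theorem saddleOp_snd (x : W × Q) (q : Q) : (saddleOp a b x).2 q = -b x.1 q := by
  simp [saddleOp]

theorem saddleNorm_nonneg (x : W × Q) : 0 ≤ saddleNorm a d b x :=
  Real.sqrt_nonneg _

theorem saddleNorm_zero : saddleNorm a d b 0 = 0 := by
  simp [saddleNorm]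

theorem saddleNorm_neg_snd (r : W) (q : Q) :
    saddleNorm a d b (r, -q) = saddleNorm a d b (r, q) := by
  simp only [saddleNorm, map_neg, LinearMap.neg_apply, neg_neg]

theorem saddleComp_zero_left (y : W × Q) : saddleComp a d b 0 y = 0 := by
  simp [saddleComp]

namespace IsSaddle

theorem a_nonneg (H : IsSaddle a d b) (r : W) : 0 ≤ a r r :=
  apply_self_nonneg_of_pos H.a_pos r

theorem d_nonneg (H : IsSaddle a d b) (r : W) : 0 ≤ d r r :=
  apply_self_nonneg_of_pos H.d_pos r

theorem inner_symm (H : IsSaddle a d b) (x y : W × Q) :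
    saddleInner a d b x y = saddleInner a d b y x := by
  rw [saddleInner_apply, saddleInner_apply, H.a_symm, H.d_symm]

theorem inner_nonneg (H : IsSaddle a d b) (x : W × Q) : 0 ≤ saddleInner a d b x x :=
  add_nonneg (H.a_nonneg _) (H.d_nonneg _)

theorem norm_sq (H : IsSaddle a d b) (x : W × Q) :
    saddleNorm a d b x ^ 2 = saddleInner a d b x x :=
  Real.sq_sqrt (H.inner_nonneg x)

theorem inner_le (H : IsSaddle a d b) (x y : W × Q) :
    saddleInner a d b x y ≤ saddleNorm a d b x * saddleNorm a d b y :=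
  le_of_abs_le (abs_apply_le_sqrt_mul_sqrt H.inner_symm H.inner_nonneg x y)

theorem sqrt_a_le (H : IsSaddle a d b) (x : W × Q) : √(a x.1 x.1) ≤ saddleNorm a d b x :=
  Real.sqrt_le_sqrt (le_add_of_nonneg_right (H.d_nonneg _))

theorem sqrt_d_grad_le (H : IsSaddle a d b) (x : W × Q) :
    √(d (saddleGrad d b x.2) (saddleGrad d b x.2)) ≤ saddleNorm a d b x :=
  Real.sqrt_le_sqrt (le_add_of_nonneg_left (H.a_nonneg _))

theorem comp_symm (H : IsSaddle a d b) (x y : W × Q) :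
    saddleComp a d b x y = saddleComp a d b y x := by
  simp only [saddleComp, H.a_symm x.1 y.1]
  ring

theorem abs_a_le (H : IsSaddle a d b) (x y : W × Q) :
    |a x.1 y.1| ≤ saddleNorm a d b x * saddleNorm a d b y :=
  (abs_apply_le_sqrt_mul_sqrt H.a_symm H.a_nonneg _ _).trans <|
    mul_le_mul (H.sqrt_a_le x) (H.sqrt_a_le y) (Real.sqrt_nonneg _) (saddleNorm_nonneg x)

theorem abs_d_grad_le (H : IsSaddle a d b) {C : ℝ} (hC : 0 ≤ C) (h : ∀ r, d r r ≤ C * a r r)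
    (x y : W × Q) : |d (saddleGrad d b x.2) y.1| ≤
      √C * (saddleNorm a d b x * saddleNorm a d b y) := by
  have hy : √(d y.1 y.1) ≤ √C * saddleNorm a d b y :=
    calc √(d y.1 y.1) ≤ √C * √(a y.1 y.1) := by
          rw [← Real.sqrt_mul hC]
          exact Real.sqrt_le_sqrt (h y.1)
      _ ≤ √C * saddleNorm a d b y := mul_le_mul_of_nonneg_left (H.sqrt_a_le y) (Real.sqrt_nonneg C)
  calc |d (saddleGrad d b x.2) y.1|
      ≤ √(d (saddleGrad d b x.2) (saddleGrad d b x.2)) * √(d y.1 y.1) :=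
        abs_apply_le_sqrt_mul_sqrt H.d_symm H.d_nonneg _ _
    _ ≤ saddleNorm a d b x * (√C * saddleNorm a d b y) :=
        mul_le_mul (H.sqrt_d_grad_le x) hy (Real.sqrt_nonneg _) (saddleNorm_nonneg x)
    _ = √C * (saddleNorm a d b x * saddleNorm a d b y) := mul_left_comm _ _ _

theorem abs_comp_le (H : IsSaddle a d b) {C : ℝ} (hC : 0 ≤ C) (h : ∀ r, d r r ≤ C * a r r)
    (x y : W × Q) : |saddleComp a d b x y| ≤
      (1 + 2 * √C) * saddleNorm a d b x * saddleNorm a d b y :=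
  calc |saddleComp a d b x y|
      ≤ |a x.1 y.1| + |d (saddleGrad d b x.2) y.1| + |d (saddleGrad d b y.2) x.1| :=
        abs_add_three _ _ _
    _ ≤ saddleNorm a d b x * saddleNorm a d b y +
          √C * (saddleNorm a d b x * saddleNorm a d b y) +
          √C * (saddleNorm a d b y * saddleNorm a d b x) :=
        add_le_add_three (H.abs_a_le x y) (H.abs_d_grad_le hC h x y) (H.abs_d_grad_le hC h y x)
    _ = (1 + 2 * √C) * saddleNorm a d b x * saddleNorm a d b y := by ring

theorem exists_norm_sq_le_comp (H : IsSaddle a d b) {C : ℝ} (hC : 1 ≤ C)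
    (h : ∀ r, a r r ≤ C * d r r) (y : W × Q) :
    ∃ x, saddleNorm a d b x ≤ 2 * saddleNorm a d b y ∧
      saddleNorm a d b y ^ 2 ≤ 2 * C * saddleComp a d b x y := by
  -- Flipping the sign of `q` cancels `d(g, r)`, and `u` contributes `d(g, u) = C⁻¹ d(g, g)`, which
  -- dominates `a(u, u)` and hence absorbs the cross term `a(u, r)`.
  obtain ⟨r, q⟩ := y
  set g := saddleGrad d b q with hg
  let u := C⁻¹ • g
  have hC0 : 0 < C := one_pos.trans_le hC
  have hdu : C * d g u = d g g := by
    rw [map_smul, smul_eq_mul, mul_inv_cancel_left₀ hC0.ne']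
  have hau : a u u ≤ d g u := by
    have hu := h u
    rwa [map_smul d, LinearMap.smul_apply, smul_eq_mul, mul_inv_cancel_left₀ hC0.ne'] at hu
  have hdle : d g u ≤ d g g := by nlinarith [(H.a_nonneg u).trans hau]
  have hru := abs_le.1 (show |a u r| ≤ (a r r + a u u) / 2 by
    linarith [two_mul_abs_apply_le H.a_symm H.a_nonneg r u])
  have hy : saddleNorm a d b (r, q) ^ 2 = a r r + d g g := H.norm_sq _
  have hx : saddleNorm a d b (r + u, -q) ^ 2 = a r r + 2 * a u r + a u u + d g g := by
    rw [saddleNorm_neg_snd, H.norm_sq, saddleInner_apply, apply_add_self H.a_symm]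
  have hcomp : saddleComp a d b (r + u, -q) (r, q) = a r r + a u r + d g u := by
    simp only [saddleComp, map_add, map_neg, LinearMap.add_apply, LinearMap.neg_apply, ← hg]
    ring
  refine ⟨(r + u, -q), le_of_sq_le_sq ?_ (mul_nonneg zero_le_two (saddleNorm_nonneg _)), ?_⟩
  · rw [mul_pow, hx, hy]
    linarith [H.a_nonneg r]
  · rw [hy, hcomp, ← hdu]
    nlinarith [H.a_nonneg r, mul_le_mul_of_nonneg_left hau hC0.le]

variable [FiniteDimensional ℝ W]

theorem bijective_a (H : IsSaddle a d b) : Function.Bijective (a : W →ₗ[ℝ] Module.Dual ℝ W) :=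
  bijective_of_apply_self_ne_zero fun r hr => (H.a_pos r hr).ne'

theorem bijective_d (H : IsSaddle a d b) : Function.Bijective (d : W →ₗ[ℝ] Module.Dual ℝ W) :=
  bijective_of_apply_self_ne_zero fun r hr => (H.d_pos r hr).ne'

theorem d_grad (H : IsSaddle a d b) (p : Q) (r : W) : d (saddleGrad d b p) r = b r p :=
  LinearMap.congr_fun (apply_inv H.bijective_d (b.flip p)) r

theorem grad_ne_zero (H : IsSaddle a d b) {p : Q} (hp : p ≠ 0) : saddleGrad d b p ≠ 0 := by
  refine fun h => hp (H.eq_zero p fun r => ?_)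
  rw [← H.d_grad, h, map_zero, LinearMap.zero_apply]

theorem schur_apply (H : IsSaddle a d b) (p q : Q) :
    saddleSchur d b p q = d (saddleGrad d b q) (saddleGrad d b p) :=
  (H.d_grad q (saddleGrad d b p)).symm

theorem norm_pos (H : IsSaddle a d b) (x : W × Q) (hx : x ≠ 0) : 0 < saddleNorm a d b x := by
  refine Real.sqrt_pos.2 ?_
  by_cases h : x.1 = 0
  · exact add_pos_of_nonneg_of_pos (H.a_nonneg _)
      (H.d_pos _ (H.grad_ne_zero fun h' => hx (Prod.ext h h')))
  · exact add_pos_of_pos_of_nonneg (H.a_pos _ h) (H.d_nonneg _)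

theorem infSup (H : IsSaddle a d b) {C : ℝ} (hC : 1 ≤ C) (h : ∀ r, a r r ≤ C * d r r) :
    (((4 * C)⁻¹ : ℝ) : EReal) ≤ ⨅ (y : W × Q) (_ : y ≠ 0), ⨆ (x : W × Q) (_ : x ≠ 0),
      ((saddleComp a d b x y / (saddleNorm a d b x * saddleNorm a d b y) : ℝ) : EReal) := by
  refine le_iInf₂ fun y hy => ?_
  obtain ⟨x, hxy, hcomp⟩ := H.exists_norm_sq_le_comp hC h y
  have hC0 : 0 < C := one_pos.trans_le hC
  have hy0 := H.norm_pos y hy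
  have hx : x ≠ 0 := by
    rintro rfl
    rw [saddleComp_zero_left, mul_zero] at hcomp
    exact (pow_pos hy0 2).not_ge hcomp
  refine le_iSup₂_of_le x hx (EReal.coe_le_coe_iff.2 ?_)
  rw [le_div_iff₀ (mul_pos (H.norm_pos x hx) hy0), inv_mul_le_iff₀ (mul_pos four_pos hC0)]
  linarith [mul_le_mul_of_nonneg_right hxy hy0.le]

variable [FiniteDimensional ℝ Q]

theorem bijective_schur (H : IsSaddle a d b) : Function.Bijective (saddleSchur d b) :=
  bijective_of_apply_self_ne_zero fun p hp => by
    rw [H.schur_apply]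
    exact (H.d_pos _ (H.grad_ne_zero hp)).ne'

theorem bijective_prodMap (H : IsSaddle a d b) :
    Function.Bijective (LinearMap.prodMap (M₃ := Module.Dual ℝ W) a (saddleSchur d b)) := by
  rw [LinearMap.coe_prodMap]
  exact H.bijective_a.prodMap H.bijective_schur

theorem inner_precond (H : IsSaddle a d b) (x : W × Q) (r : W) (q : Q) :
    saddleInner a d b ((saddlePrecond a d b ∘ₗ saddleOp a b) x) (r, q) =
      saddleComp a d b x (r, -q) := by
  set y := (saddlePrecond a d b ∘ₗ saddleOp a b) x
  have hy : LinearMap.prodMap (M₃ := Module.Dual ℝ W) a (saddleSchur d b) y = saddleOp a b x :=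
    apply_inv H.bijective_prodMap _
  have hfst : a y.1 r = a x.1 r + b r x.2 := by
    rw [← saddleOp_fst, ← hy]
    rfl
  have hsnd : d (saddleGrad d b q) (saddleGrad d b y.2) = -b x.1 q := by
    rw [← saddleOp_snd (a := a), ← hy, ← H.schur_apply]
    rfl
  rw [saddleInner_apply, hfst, H.d_symm, hsnd, ← H.d_grad, ← H.d_grad, saddleComp]
  simp only [map_neg, LinearMap.neg_apply]

theorem norm_precond_le (H : IsSaddle a d b) {α : ℝ} (hα : 0 ≤ α)
    (hcont : ∀ x y, |saddleComp a d b x y| ≤ α * saddleNorm a d b x * saddleNorm a d b y)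
    (x : W × Q) : saddleNorm a d b ((saddlePrecond a d b ∘ₗ saddleOp a b) x) ≤
      α * saddleNorm a d b x := by
  set z := (saddlePrecond a d b ∘ₗ saddleOp a b) x with hz
  obtain hz0 | hz0 := eq_or_ne z 0
  · rw [hz0, saddleNorm_zero]
    exact mul_nonneg hα (saddleNorm_nonneg x)
  have h := le_of_abs_le (hcont x (z.1, -z.2))
  rw [← H.inner_precond, saddleNorm_neg_snd, ← hz, ← H.norm_sq, sq] at h
  exact le_of_mul_le_mul_right h (H.norm_pos z hz0)

theorem le_norm_precond (H : IsSaddle a d b) {β : ℝ}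
    (hinfSup : (β : EReal) ≤ ⨅ (y : W × Q) (_ : y ≠ 0), ⨆ (x : W × Q) (_ : x ≠ 0),
      ((saddleComp a d b x y / (saddleNorm a d b x * saddleNorm a d b y) : ℝ) : EReal))
    (x : W × Q) : β * saddleNorm a d b x ≤
      saddleNorm a d b ((saddlePrecond a d b ∘ₗ saddleOp a b) x) := by
  obtain rfl | hx0 := eq_or_ne x 0
  · rw [map_zero, saddleNorm_zero, mul_zero]
  have hx := H.norm_pos x hx0
  set N := saddleNorm a d b ((saddlePrecond a d b ∘ₗ saddleOp a b) x)
  have hcomp (z : W × Q) : saddleComp a d b z x ≤ N * saddleNorm a d b z := by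
    have h := H.inner_le ((saddlePrecond a d b ∘ₗ saddleOp a b) x) (z.1, -z.2)
    rwa [saddleNorm_neg_snd, H.inner_precond, neg_neg, H.comp_symm] at h
  have hβ : (β : EReal) ≤ ((N / saddleNorm a d b x : ℝ) : EReal) := by
    refine (le_iInf₂_iff.1 hinfSup x hx0).trans (iSup₂_le fun z hz0 => ?_)
    have hz := H.norm_pos z hz0
    rw [EReal.coe_le_coe_iff, div_le_div_iff₀ (mul_pos hz hx) hx, ← mul_assoc]
    exact mul_le_mul_of_nonneg_right (hcomp z) hx.le
  rwa [EReal.coe_le_coe_iff, le_div_iff₀ hx] at hβ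

theorem bijective_saddleOp (H : IsSaddle a d b) : Function.Bijective (saddleOp a b) := by
  have hinj : Function.Injective (saddleOp a b) := by
    refine (injective_iff_map_eq_zero _).2 fun x hx => ?_
    have hfst (r : W) : a x.1 r + b r x.2 = 0 := by
      rw [← saddleOp_fst, hx]
      rfl
    have hsnd : b x.1 x.2 = 0 := by
      rw [← neg_eq_zero, ← saddleOp_snd (a := a), hx]
      rfl
    have hx1 : x.1 = 0 := by
      by_contra h
      exact (H.a_pos _ h).ne' (by simpa only [hsnd, add_zero] using hfst x.1)
    exact Prod.ext hx1 (H.eq_zero _ fun r => by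
      simpa only [hx1, map_zero, LinearMap.zero_apply, zero_add] using hfst r)
  have hrank : Module.finrank ℝ (W × Q) =
      Module.finrank ℝ (Module.Dual ℝ W × Module.Dual ℝ Q) := by
    rw [Module.finrank_prod, Module.finrank_prod, Subspace.dual_finrank_eq,
      Subspace.dual_finrank_eq]
  exact ⟨hinj, (LinearMap.injective_iff_surjective_of_finrank_eq_finrank hrank).1 hinj⟩

theorem condNumber_le (H : IsSaddle a d b) {α β : ℝ} (hα : 0 < α) (hβ : 0 < β)
    (hcont : ∀ x y, |saddleComp a d b x y| ≤ α * saddleNorm a d b x * saddleNorm a d b y)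
    (hinfSup : (β : EReal) ≤ ⨅ (y : W × Q) (_ : y ≠ 0), ⨆ (x : W × Q) (_ : x ≠ 0),
      ((saddleComp a d b x y / (saddleNorm a d b x * saddleNorm a d b y) : ℝ) : EReal)) :
    condNumber (saddleNorm a d b) (saddlePrecond a d b ∘ₗ saddleOp a b) ≤
      ENNReal.ofReal (α / β) :=
  condNumber_le_of_bijective ((bijective_inv H.bijective_prodMap).comp H.bijective_saddleOp)
    hα.le hβ (H.norm_precond_le hα.le hcont) (H.le_norm_precond hinfSup)

end IsSaddle

end

/-! ### The discrete problem -/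

theorem isSaddle {n : ℕ} {M : MixedDimMesh n} (P : Params M) :
    IsSaddle (W := W M) (Q := Q M) (aForm P) (aDForm P) (bForm M) where
  a_symm := aForm_comm P
  d_symm := aDForm_comm P
  a_pos _ hr := aForm_pos hr
  d_pos r hr := pos_of_mul_pos_right ((aForm_pos hr).trans_le (aForm_self_le P r)) (by positivity)
  eq_zero _ hp := eq_zero_of_bForm hp

theorem continuity_of_aDForm_self_le {n : ℕ} {M : MixedDimMesh n} {P : Params M} {C : ℝ}
    (hC : 0 ≤ C) (h : ∀ r, aDForm P r r ≤ C * aForm P r r) : Continuity P (1 + 2 * √C) :=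
  (isSaddle P).abs_comp_le hC h

theorem infSup_of_aForm_self_le {n : ℕ} {M : MixedDimMesh n} {P : Params M} {C : ℝ}
    (hC : 1 ≤ C) (h : ∀ r, aForm P r r ≤ C * aDForm P r r) : InfSup P (4 * C)⁻¹ :=
  (isSaddle P).infSup hC h

end MixedDim

theorem mainTheorem4_general (N : ℕ) (σ τ : ℝ) :
    ∃ α β : ℝ, 0 < α ∧ 0 < β ∧
      ∀ n ≤ N, ∀ (M : MixedDim.MixedDimMesh n) (P : MixedDim.Params M),
        M.ShapeRegular σ → P.AnisotropyLE τ →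
          (Function.Bijective (MixedDim.opA P) ∧ Function.Bijective (MixedDim.opDA P) ∧
            Function.Bijective (MixedDim.opS P) ∧ Function.Bijective (MixedDim.sysOp P) ∧
            ∀ x : MixedDim.X M, x ≠ 0 → 0 < MixedDim.triNorm P x) ∧
          (MixedDim.Continuity P α ∧ MixedDim.InfSup P β) ∧
          MixedDim.condNumber (MixedDim.triNorm P) (MixedDim.precond P ∘ₗ MixedDim.sysOp P) ≤
            ENNReal.ofReal (α / β) ∧
          ∀ α' β' : ℝ, 0 < α' → 0 < β' → MixedDim.Continuity P α' → MixedDim.InfSup P β' →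
            MixedDim.condNumber (MixedDim.triNorm P) (MixedDim.precond P ∘ₗ MixedDim.sysOp P) ≤
              ENNReal.ofReal (α' / β') := by
  let C : ℝ := (N + 1) * ((2 ^ (N + 3) + 2) * σ ^ 2 * |τ|) + 1
  have hC : 0 ≤ C := by positivity
  refine ⟨1 + 2 * √C, (4 * (N + 1 : ℝ))⁻¹, by positivity, by positivity,
    fun n hn M P hσ hτ => ?_⟩
  have H := MixedDim.isSaddle P
  have hcontinuity : MixedDim.Continuity P (1 + 2 * √C) := by
    refine MixedDim.continuity_of_aDForm_self_le hC fun r =>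
      (MixedDim.aDForm_self_le hσ hτ r).trans (mul_le_mul_of_nonneg_right ?_ (H.a_nonneg r))
    simp only [C]
    gcongr
    exact one_le_two
  have hinfSup : MixedDim.InfSup P (4 * (N + 1 : ℝ))⁻¹ := by
    refine MixedDim.infSup_of_aForm_self_le (by linarith [N.cast_nonneg (α := ℝ)]) fun r =>
      (MixedDim.aForm_self_le P r).trans (mul_le_mul_of_nonneg_right ?_ (H.d_nonneg r))
    gcongr
  exact ⟨⟨H.bijective_a, H.bijective_d, H.bijective_schur, H.bijective_saddleOp, H.norm_pos⟩,
    ⟨hcontinuity, hinfSup⟩,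
    H.condNumber_le (by positivity) (by positivity) hcontinuity hinfSup,
    fun α' β' hα hβ => H.condNumber_le hα hβ⟩

theorem mainTheorem4 (σ τ : ℝ) :
    ∃ α β : ℝ, 0 < α ∧ 0 < β ∧
      ∀ (n : ℕ), n = 2 ∨ n = 3 → ∀ (M : MixedDim.MixedDimMesh n) (P : MixedDim.Params M),
        M.ShapeRegular σ → P.AnisotropyLE τ →
          -- all inverses exist, and the weighted norm is positive definite
          (Function.Bijective (MixedDim.opA P) ∧ Function.Bijective (MixedDim.opDA P) ∧
            Function.Bijective (MixedDim.opS P) ∧ Function.Bijective (MixedDim.sysOp P) ∧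
            ∀ x : MixedDim.X M, x ≠ 0 → 0 < MixedDim.triNorm P x) ∧
          -- the composite form is well-posed with the uniform constants
          (MixedDim.Continuity P α ∧ MixedDim.InfSup P β) ∧
          -- the bound of the condition number with the uniform constants
          MixedDim.condNumber (MixedDim.triNorm P) (MixedDim.precond P ∘ₗ MixedDim.sysOp P) ≤
            ENNReal.ofReal (α / β) ∧
          -- the bound with any constants of continuity and inf-sup
          ∀ α' β' : ℝ, 0 < α' → 0 < β' → MixedDim.Continuity P α' → MixedDim.InfSup P β' →
            MixedDim.condNumber (MixedDim.triNorm P) (MixedDim.precond P ∘ₗ MixedDim.sysOp P) ≤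
              ENNReal.ofReal (α' / β') := by
  obtain ⟨α, β, hα, hβ, h⟩ := mainTheorem4_general 3 σ τ
  exact ⟨α, β, hα, hβ, fun n hn => h n (by omega)⟩
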